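/- Let $d\ge 1$, let $W\subset\mathbb R^d$ be compact and convex with volume $V(W)>0$, and let $S(W)$ be its surface area, i.e. the $(d-1)$-dimensional Hausdorff measure of its boundary. Let $\kappa_d$ denote the volume of the unit ball of $\mathbb R^d$. For every $t>0$ let $\eta_t$ be the restriction to $W$ of a homogeneous Poisson point process of intensity $t$ in $\mathbb R^d$ (all defined on one probability space), and let $(\delta_t)_{t>0}$ be positive real numbers with $\delta_t\to 0$ as $t\to\infty$. For $\alpha\in\mathbb R$ put $$L_t^{(\alpha)}=\frac12\sum_{(x,y)\in\eta_t^2,\ x\neq y}\mathbf 1(\|x-y\|\le\delta_t)\,\|x-y\|^\alpha .$$ (a) Let $\alpha,\beta>-d$ with $\alpha+\beta>-d$. Then for every $t>0$ the variables $L_t^{(\alpha)}$, $L_t^{(\beta)}$ and $L_t^{(\alpha)}L_t^{(\beta)}$ are integrable, and $$\left(\sigma_1 t^2\delta_t^{\alpha+\beta+d}+\sigma_2 t^3\delta_t^{\alpha+\beta+2d}\right)\bigl(V(W)-S(W)\delta_t\bigr)\le \operatorname{Cov}\bigl(L_t^{(\alpha)},L_t^{(\beta)}\bigr)\le \left(\sigma_1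 t^2\delta_t^{\alpha+\beta+d}+\sigma_2 t^3\delta_t^{\alpha+\beta+2d}\right)V(W),$$ where $$\sigma_1=\frac{d\,\kappa_d}{2(\alpha+\beta+d)},\qquad \sigma_2=\frac{d^2\kappa_d^2}{(\alpha+d)(\beta+d)} .$$ (b) Let $\alpha_1,\dots,\alpha_m>-d/2$ be distinct and put $\widetilde L_t^{(\alpha_i)}=L_t^{(\alpha_i)}/\max\{t\,\delta_t^{\alpha_i+d/2},\,t^{3/2}\delta_t^{\alpha_i+d}\}$. Then $$\lim_{t\to\infty}\Bigl(\operatorname{Cov}\bigl(\widetilde L_t^{(\alpha_i)},\widetilde L_t^{(\alpha_j)}\bigr)\Bigr)_{i,j=1}^m=\begin{cases}\Sigma_1 &\text{if }\lim_{t\to\infty} t\delta_t^d=0,\\ \Sigma_1+c\,\Sigma_2 &\text{if }\lim_{t\to\infty} t\delta_t^d=c\in(0,1],\\ \frac1c\,\Sigma_1+\Sigma_2 &\text{if }\lim_{t\to\infty} t\delta_t^d=c\in(1,\infty),\\ \Sigma_2 &\text{if }\lim_{t\to\infty} t\delta_t^d=\infty,\end{cases}$$ where $$\Sigma_1=\frac{d\,\kappa_d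 V(W)}{2}\left(\frac1{\alpha_i+\alpha_j+d}\right)_{i,j=1}^m,\qquad \Sigma_2=d^2\kappa_d^2V(W)\left(\frac1{(\alpha_i+d)(\alpha_j+d)}\right)_{i,j=1}^m .$$ (c) For every $\alpha>-d/2$ the variable $L_t^{(\alpha)}$ is square-integrable for every $t>0$, and, as $t\to\infty$, $$\operatorname{Var}L_t^{(\alpha)}=\left(\frac{d\,\kappa_d}{2(2\alpha+d)}\,t^2\delta_t^{2\alpha+d}+\frac{d^2\kappa_d^2}{(\alpha+d)^2}\,t^3\delta_t^{2\alpha+2d}\right)V(W)\,\bigl(1+O(\delta_t)\bigr),$$ where $O(\delta_t)$ stands for a quantity whose absolute value is bounded by a constant multiple of $\delta_t$ for all sufficiently large $t$. -/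

import Mathlib

open MeasureTheory ProbabilityTheory Filter Topology Asymptotics

noncomputable section

namespace Gilbert

/-- `κ_d`, the volume of the unit ball of `ℝ^d`. -/
def kappa (d : ℕ) : ℝ :=
  (volume : Measure (EuclideanSpace ℝ (Fin d))).real (Metric.closedBall 0 1)

/-- Volume `V(W)`, i.e. Lebesgue measure. -/
def vol {d : ℕ} (W : Set (EuclideanSpace ℝ (Fin d))) : ℝ :=
  (volume : Measure (EuclideanSpace ℝ (Fin d))).real W

/-- Surface area `S(W)`: the `(d-1)`-dimensional Hausdorff measure of the boundary, in the
Euclidean normalization (a unit cube of dimension `d - 1` has measure one). For `d = 1` it is the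
number of boundary points. -/
def surfaceArea {d : ℕ} (W : Set (EuclideanSpace ℝ (Fin d))) : ℝ :=
  (Measure.euclideanHausdorffMeasure (d - 1) : Measure (EuclideanSpace ℝ (Fin d))).real (frontier W)

open Classical in
/-- The number of points of the configuration `s` in the set `A`. -/
def count {E : Type*} (s : Finset E) (A : Set E) : ℕ :=
  (s.filter (fun x => x ∈ A)).card

/-- `η` is (the restriction to `W` of) a homogeneous Poisson point process of intensity `t`: a
random finite set of points of `W` such that the number of points in a Borel set `A` is Poisson
distributed with mean `t * vol (A ∩ W)`, and such that the numbers of points in pairwise disjoint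
Borel sets are independent. -/
structure IsPoissonProcess {d : ℕ} {Ω : Type*} [MeasurableSpace Ω] (P : Measure Ω)
    (W : Set (EuclideanSpace ℝ (Fin d))) (t : ℝ)
    (η : Ω → Finset (EuclideanSpace ℝ (Fin d))) : Prop where
  subset : ∀ ω, (η ω : Set (EuclideanSpace ℝ (Fin d))) ⊆ W
  measurable_count : ∀ A : Set (EuclideanSpace ℝ (Fin d)), MeasurableSet A →
    Measurable (fun ω => count (η ω) A)
  map_count : ∀ A : Set (EuclideanSpace ℝ (Fin d)), MeasurableSet A →
    P.map (fun ω => count (η ω) A) = poissonMeasure (t * vol (A ∩ W)).toNNReal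
  indep_count : ∀ (n : ℕ) (A : Fin n → Set (EuclideanSpace ℝ (Fin d))),
    (∀ i, MeasurableSet (A i)) → Pairwise (fun i j => Disjoint (A i) (A j)) →
    iIndepFun (fun i ω => count (η ω) (A i)) P

open Classical in
/-- The length-power functional of the Gilbert graph with vertex set `s` and distance parameter
`r`: one half of the sum over all ordered pairs of distinct points of `s` at distance at most `r`
of the `α`-th power of the distance. -/
def lengthPower {d : ℕ} (r α : ℝ) (s : Finset (EuclideanSpace ℝ (Fin d))) : ℝ :=
  (1 / 2) * ∑ p ∈ s.offDiag, if dist p.1 p.2 ≤ r then dist p.1 p.2 ^ α else 0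

/-- The normalization `max {t δ^(α + d/2), t^(3/2) δ^(α + d)}`. -/
def scale (d : ℕ) (t r α : ℝ) : ℝ :=
  max (t * r ^ (α + (d : ℝ) / 2)) (t ^ (3 / 2 : ℝ) * r ^ (α + (d : ℝ)))

/-- `σ₁ = d κ_d / (2 (α + β + d))`. -/
def sigma1 (d : ℕ) (α β : ℝ) : ℝ := d * kappa d / (2 * (α + β + d))

/-- `σ₂ = d² κ_d² / ((α + d) (β + d))`. -/
def sigma2 (d : ℕ) (α β : ℝ) : ℝ := (d : ℝ) ^ 2 * kappa d ^ 2 / ((α + d) * (β + d))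

/-- The matrix `Σ₁`. -/
def Sigma1 {d : ℕ} (W : Set (EuclideanSpace ℝ (Fin d))) {m : ℕ} (α : Fin m → ℝ) :
    Matrix (Fin m) (Fin m) ℝ :=
  (d * kappa d * vol W / 2) • Matrix.of fun i j => 1 / (α i + α j + d)

/-- The matrix `Σ₂`. -/
def Sigma2 {d : ℕ} (W : Set (EuclideanSpace ℝ (Fin d))) {m : ℕ} (α : Fin m → ℝ) :
    Matrix (Fin m) (Fin m) ℝ :=
  ((d : ℝ) ^ 2 * kappa d ^ 2 * vol W) • Matrix.of fun i j => 1 / ((α i + d) * (α j + d))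

/-- The covariance matrix of the rescaled length-power functionals. -/
def covMatrix {d : ℕ} {Ω : Type*} [MeasurableSpace Ω] (P : Measure Ω)
    (η : Ω → Finset (EuclideanSpace ℝ (Fin d))) (t r : ℝ) {m : ℕ} (α : Fin m → ℝ) :
    Matrix (Fin m) (Fin m) ℝ :=
  Matrix.of fun i j =>
    covariance (fun ω => lengthPower r (α i) (η ω) / scale d t r (α i))
      (fun ω => lengthPower r (α j) (η ω) / scale d t r (α j)) P

end Gilbert

end

/-!
The centred second moments of the length-power functionals of the Gilbert graph on a Poisson process
are computed exactly and then bounded by elementary geometry.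

*Moments.* For pairwise disjoint sets the counts of the process are independent, so the expected
number of `k`-tuples of points in a product of disjoint sets is the product of the intensities. Such
products cover all `k`-tuples with distinct entries, hence the expected sum of a function over the
`k`-tuples of distinct points is its integral for the `k`-fold product of the intensity measure
(`IsPoissonProcess.lintegral_sum_distinctTuples`). Sorting the pairs of pairs occurring in
`L^(α) L^(β)` by the number of common points yields tuples of four, three and two distinct points
(`sum_offDiag_mul_sum_offDiag`). The first contribution is the product of the means, so the
covariance is the sum of the other two (`IsPoissonProcess.lintegral_lengthPower_mul`):
`t³ ∫ I_α I_β + t² / 2 ∫ I_{α+β}` over `W`, where `I_γ(x)` is the integral of `|x - y| ^ γ` over the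
points `y` of `W` at distance at most `δ` from `x`.

*Bounds.* In polar coordinates `I_γ(x) ≤ d κ_d δ ^ (γ + d) / (γ + d)`, with equality when the
closed `δ`-ball around `x` lies in `W`. The upper bound follows, and the lower bound is reduced to
`V(W) - S(W) δ ≤ vol {x | closedBall x δ ⊆ W}` (`volume_le_volume_inner_parallel_add`). For a
polytope inside `W`, almost every point within `δ` of the bounding hyperplanes has a unique nearest
one; moving the points of such a cell along the normal until they leave `W` sends them to pieces of
`∂W` which are disjoint for different facets, and the slices of the cell parallel to the facet are
contracting images of its piece. Slicing then bounds the volume of each cell by `δ` times the area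
of its piece. Polytopes squeezed between `W` and large compact subsets of its interior give the
general case. The area of `∂W` is finite because `∂W` is a finite union of Lipschitz graphs
(`hausdorffMeasure_frontier_lt_top`).

*Limits.* With `u = t δ ^ d`, dividing by the normalizations turns the leading coefficient into
`(σ₁ + σ₂ u) / max (1, u)`, and the two bounds squeeze the covariances.
-/

namespace Gilbert

open scoped RealInnerProductSpace ENNReal

noncomputable section

/-! ### Volume of inner parallel bodies of convex sets -/

section ParallelBody

theorem inner_parallel_eq_iInter {E : Type*} [SeminormedAddCommGroup E] (W : Set E) (δ : ℝ) :
    {x : E | Metric.closedBall x δ ⊆ W} =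
    ⋂ v ∈ Metric.closedBall (0 : E) δ, (fun x => x + v) ⁻¹' W := by
  ext x
  simp only [Set.mem_ofPred_eq, Set.mem_iInter, Set.mem_preimage]
  refine ⟨fun h v hv => h (by simpa using hv), fun h y hy => ?_⟩
  have := h (y - x) (by simpa [dist_eq_norm] using hy)
  simpa using this

variable {E : Type*} [NormedAddCommGroup E] [InnerProductSpace ℝ E] 

theorem isClosed_inner_parallel {E : Type*} [SeminormedAddCommGroup E] {W : Set E}
    (hW : IsClosed W) (δ : ℝ) :
    IsClosed {x : E | Metric.closedBall x δ ⊆ W} := by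
  rw [inner_parallel_eq_iInter]
  exact isClosed_biInter fun v _ => hW.preimage (by fun_prop)

theorem convex_inner_parallel {W : Set E} (hW : Convex ℝ W) (δ : ℝ) :
    Convex ℝ {x : E | Metric.closedBall x δ ⊆ W} := by
  rw [inner_parallel_eq_iInter]
  exact convex_iInter₂ fun v _ => hW.translate_preimage_left v

/-- A ray issuing from a point of a compact set meets the frontier of that set. -/
theorem exists_add_smul_mem_frontier {W : Set E} (hW : IsCompact W) {p u : E} (hp : p ∈ W)
    (hu : u ≠ 0) : ∃ r : ℝ, 0 ≤ r ∧ p + r • u ∈ frontier W := by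
  have hK : IsCompact (W ∩ ((fun r : ℝ => p + r • u) '' Set.Ici 0)) := by
    refine hW.inter_right ?_
    have hc : Topology.IsClosedEmbedding (fun r : ℝ => p + r • u) :=
      (Homeomorph.addLeft p).isClosedEmbedding.comp
        (isClosedEmbedding_smul_left (𝕜 := ℝ) hu)
    exact hc.isClosedMap _ isClosed_Ici
  obtain ⟨q, hq, hmax⟩ := hK.exists_isMaxOn (f := fun x => ⟪x, u⟫)
    ⟨p, hp, 0, by simp, by simp⟩ (by fun_prop)
  obtain ⟨hqW, r, hr, rfl⟩ := hq
  refine ⟨r, hr, subset_closure hqW, fun hint => ?_⟩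
  have hcont : Tendsto (fun s : ℝ => p + s • u) (𝓝[>] r) (𝓝 (p + r • u)) := by
    apply Tendsto.mono_left _ nhdsWithin_le_nhds
    exact Continuous.tendsto (by fun_prop) r
  obtain ⟨s, hsW, hs⟩ := ((hcont.eventually (mem_interior_iff_mem_nhds.1 hint)).and
    self_mem_nhdsWithin).exists
  have hle := hmax ⟨hsW, s, le_trans hr (le_of_lt hs), rfl⟩
  simp only [Set.mem_ofPred_eq, inner_add_left, inner_smul_left, real_inner_self_eq_norm_sq] at hle
  have : 0 < ‖u‖ ^ 2 := by positivity
  simp at hle hs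
  nlinarith

/-- A closed convex subset of the interior of a compact set can be separated from the
complement of that set by a polytope. -/
theorem exists_polytope_between [CompleteSpace E] {W K : Set E} (hW : IsCompact W) (hK : IsClosed K)
    (hKc : Convex ℝ K) (hKne : K.Nonempty) (hKW : K ⊆ interior W) :
    ∃ Q : Finset (E × ℝ), (∀ q ∈ Q, ‖q.1‖ = 1) ∧ (∀ x ∈ K, ∀ q ∈ Q, ⟪x, q.1⟫ ≤ q.2) ∧
      {x : E | ∀ q ∈ Q, ⟪x, q.1⟫ ≤ q.2} ⊆ W := by
  classical
  have hsep : ∀ y ∈ frontier W, ∃ q : E × ℝ, ‖q.1‖ = 1 ∧ (∀ x ∈ K, ⟪x, q.1⟫ ≤ q.2) ∧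
      q.2 < ⟪y, q.1⟫ := by
    intro y hy
    obtain ⟨f, s, hs, hsy⟩ := geometric_hahn_banach_closed_point hKc hK fun h => hy.2 (hKW h)
    set v := (InnerProductSpace.toDual ℝ E).symm f with hv
    have hfv : ∀ x, f x = ⟪x, v⟫ := fun x => by
      rw [real_inner_comm, hv, InnerProductSpace.toDual_symm_apply]
    have hv0 : v ≠ 0 := by
      intro h0
      obtain ⟨k, hk⟩ := hKne
      have h1 := hs k hk
      rw [hfv, h0, inner_zero_right] at h1 hsy
      exact lt_asymm h1 hsy
    have hvpos : 0 < ‖v‖ := norm_pos_iff.2 hv0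
    refine ⟨(‖v‖⁻¹ • v, ‖v‖⁻¹ * s), by simp [norm_smul, hv0], fun x hx => ?_, ?_⟩
    · simp only [inner_smul_right, ← hfv]
      have := hs x hx
      gcongr
    · simp only [inner_smul_right, ← hfv]
      gcongr
  choose! q hq1 hq2 hq3 using hsep
  have hFc : IsCompact (frontier W) := hW.of_isClosed_subset isClosed_frontier
    hW.isClosed.frontier_subset
  obtain ⟨t, ht⟩ := hFc.elim_nhds_subcover' (fun y _ => {x : E | (q y).2 < ⟪x, (q y).1⟫})
    fun y hy => (isOpen_lt (by fun_prop) (by fun_prop)).mem_nhds (hq3 y hy)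
  refine ⟨t.image fun y : frontier W => q y, ?_, ?_, ?_⟩
  · simp only [Finset.mem_image]
    rintro _ ⟨y, -, rfl⟩
    exact hq1 y y.2
  · simp only [Finset.mem_image]
    rintro x hx _ ⟨y, -, rfl⟩
    exact hq2 y y.2 x hx
  · set R : Set E := {x : E | ∀ p ∈ t.image fun y : frontier W => q y, ⟪x, p.1⟫ ≤ p.2} with hR
    have hRc : Convex ℝ R := by
      have : R = ⋂ p ∈ t.image fun y : frontier W => q y, {x : E | ⟪x, p.1⟫ ≤ p.2} := by
        ext x; simp only [hR, Set.mem_ofPred_eq, Set.mem_iInter]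
      rw [this]
      refine convex_iInter₂ fun p _ => ?_
      exact convex_halfSpace_le (IsLinearMap.mk (fun x y => inner_add_left x y p.1)
        fun c x => by simp [inner_smul_left]) _
    have hKR : K ⊆ R := by
      intro x hx p hp
      obtain ⟨y, -, rfl⟩ := Finset.mem_image.1 hp
      exact hq2 y y.2 x hx
    have hdisj : Disjoint R (frontier W) := by
      rw [Set.disjoint_left]
      intro x hxR hxF
      obtain ⟨y, hy, hlt⟩ := Set.mem_iUnion₂.1 (ht hxF)
      exact absurd (hxR _ (Finset.mem_image_of_mem _ hy)) (not_le.2 hlt)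
    obtain ⟨k, hk⟩ := hKne
    refine subset_trans ?_ interior_subset
    refine hRc.isPreconnected.subset_left_of_subset_union isOpen_interior
      (isClosed_closure (s := W)).isOpen_compl ?_ ?_ ⟨k, hKR hk, hKW hk⟩
    · exact Set.disjoint_compl_right_iff_subset.2 (interior_subset.trans subset_closure)
    · intro x hx
      by_cases hxi : x ∈ interior W
      · exact Or.inl hxi
      · exact Or.inr fun hxc => Set.disjoint_left.1 hdisj hx ⟨hxc, hxi⟩

variable [FiniteDimensional ℝ E] [MeasurableSpace E] [BorelSpace E]

/-- A set lying in a slab of width `δ` orthogonal to the unit vector `u`, each of whose points can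
be moved along `u` into `G`, has volume at most `δ` times the area of `G`. -/
theorem volume_le_of_slab {u : E} (hu : ‖u‖ = 1) {T G : Set E} (hT : MeasurableSet T) {b δ : ℝ}
    (hslab : ∀ x ∈ T, ⟪x, u⟫ ∈ Set.Ioc (b - δ) b) (hG : ∀ x ∈ T, ∃ r : ℝ, x + r • u ∈ G) :
    volume T ≤ ENNReal.ofReal δ * μHE[Module.finrank ℝ E - 1] G := by
  have hu0 : u ≠ 0 := by rintro rfl; simp at hu
  rw [← InnerProductSpace.euclideanHausdorffMeasure_eq_volume,
    EuclideanGeometry.euclideanHausdorffMeasure_eq_lintegral (0 : E) hu0 hT]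
  have hmem : ∀ (c : ℝ) (x : E),
      x ∈ AffineSubspace.mk' (c • u +ᵥ (0 : E)) (Submodule.span ℝ {u})ᗮ ↔ ⟪x, u⟫ = c := by
    intro c x
    rw [AffineSubspace.mem_mk', Submodule.mem_orthogonal_singleton_iff_inner_left]
    simp [inner_sub_left, inner_smul_left, hu, sub_eq_zero]
  have hslice : ∀ c : ℝ, μHE[Module.finrank ℝ E - 1]
      (T ∩ AffineSubspace.mk' (c • u +ᵥ (0 : E)) (Submodule.span ℝ {u})ᗮ) ≤
      (Set.Ioc (b - δ) b).indicator (fun _ => μHE[Module.finrank ℝ E - 1] G) c := by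
    intro c
    by_cases hc : c ∈ Set.Ioc (b - δ) b
    · rw [Set.indicator_of_mem hc]
      -- the orthogonal projection onto the hyperplane at height `c`
      set f : E → E := fun q => q + (c - ⟪q, u⟫) • u with hf
      have hlip : LipschitzWith 1 f := by
        refine LipschitzWith.of_dist_le_mul fun x y => ?_
        have h1 : f x - f y = (x - y) - ⟪x - y, u⟫ • u := by
          simp only [hf, inner_sub_left]; module
        rw [dist_eq_norm, dist_eq_norm, h1, NNReal.coe_one, one_mul]
        refine abs_le_of_sq_le_sq' ?_ (norm_nonneg _) |>.2
        rw [norm_sub_sq_real, norm_smul, inner_smul_right, hu]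
        simp only [Real.norm_eq_abs, mul_one, sq_abs]
        nlinarith [sq_nonneg ⟪x - y, u⟫]
      have hsub : T ∩ AffineSubspace.mk' (c • u +ᵥ (0 : E)) (Submodule.span ℝ {u})ᗮ ⊆ f '' G := by
        rintro x ⟨hxT, hx⟩
        obtain ⟨r, hr⟩ := hG x hxT
        refine ⟨_, hr, ?_⟩
        have hx' := (hmem c x).1 hx
        simp only [hf, inner_add_left, inner_smul_left, real_inner_self_eq_norm_sq, hu, hx']
        simp
      refine (measure_mono hsub).trans ?_
      simp only [Measure.euclideanHausdorffMeasure_def, Measure.smul_apply]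
      have := hlip.hausdorffMeasure_image_le (d := ((Module.finrank ℝ E - 1 : ℕ) : ℝ))
        (by positivity) G
      rw [ENNReal.coe_one, ENNReal.one_rpow, one_mul] at this
      exact mul_le_mul_right this _
    · rw [Set.indicator_of_notMem hc, nonpos_iff_eq_zero]
      convert measure_empty (μ := (μHE[Module.finrank ℝ E - 1] : Measure E))
      ext x
      simp only [Set.mem_inter_iff, Set.mem_empty_iff_false, iff_false, not_and]
      intro hxT hx
      exact hc ((hmem c x).1 hx ▸ hslab x hxT)
  calc _ ≤ ‖u‖ₑ * ∫⁻ c : ℝ, (Set.Ioc (b - δ) b).indicator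
        (fun _ => μHE[Module.finrank ℝ E - 1] G) c := by gcongr with c; exact hslice c
    _ = _ := by
      have : ‖u‖ₑ = 1 := by rw [← ofReal_norm, hu, ENNReal.ofReal_one]
      rw [lintegral_indicator measurableSet_Ioc, lintegral_const, this]
      simp [mul_comm]

/-- For two distinct half-spaces `⟪x, u⟫ ≤ b`, the points with the same slack `b - ⟪x, u⟫` form a
null set: they lie in a hyperplane, or there are none if the normals agree. -/
theorem volume_slack_eq_slack {p q : E × ℝ} (hpq : p ≠ q) :
    volume {x : E | p.2 - ⟪x, p.1⟫ = q.2 - ⟪x, q.1⟫} = 0 := by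
  by_cases h1 : p.1 = q.1
  · have h2 : p.2 ≠ q.2 := fun h => hpq (Prod.ext h1 h)
    convert measure_empty (μ := (volume : Measure E))
    ext x
    simp [h1, h2]
  · let A : AffineSubspace ℝ E :=
      { carrier := {x : E | p.2 - ⟪x, p.1⟫ = q.2 - ⟪x, q.1⟫}
        smul_vsub_vadd_mem' := by
          intro c x y z hx hy hz
          simp only [Set.mem_ofPred_eq, vsub_eq_sub, vadd_eq_add, inner_add_left, inner_smul_left,
            inner_sub_left, RCLike.conj_to_real] at *
          linear_combination c * hx - c * hy + hz }
    refine Measure.addHaar_affineSubspace volume A fun htop => h1 ?_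
    have hall : ∀ x : E, p.2 - ⟪x, p.1⟫ = q.2 - ⟪x, q.1⟫ := fun x => by
      have : x ∈ A := htop ▸ AffineSubspace.mem_top ℝ E x
      exact this
    have h0 := hall 0
    have h2 := hall (p.1 - q.1)
    simp only [inner_zero_left, sub_zero] at h0
    rw [← sub_eq_zero, ← inner_self_eq_zero (𝕜 := ℝ), inner_sub_right]
    linarith

/-- Let the polytope `{x | ⟪x, u⟫ ≤ b for all (u, b) ∈ Q}` be contained in the compact set `W`. The
part of the polytope within distance `δ` of one of its bounding hyperplanes has volume at most `δ`
times the area of the frontier of `W`. -/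
theorem volume_polytope_shell_le {W : Set E} (hW : IsCompact W) (Q : Finset (E × ℝ))
    (hQ : ∀ q ∈ Q, ‖q.1‖ = 1) (hQW : {x : E | ∀ q ∈ Q, ⟪x, q.1⟫ ≤ q.2} ⊆ W) (δ : ℝ) :
    volume {x : E | (∀ q ∈ Q, ⟪x, q.1⟫ ≤ q.2) ∧ ∃ q ∈ Q, q.2 - δ < ⟪x, q.1⟫} ≤
      ENNReal.ofReal δ * μHE[Module.finrank ℝ E - 1] (frontier W) := by
  classical
  -- `T q`: the points whose slack is smallest for `q` only; `G q`: the part of the frontier of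
  -- `W` lying over the relative interior of the facet `q`
  let T : E × ℝ → Set E := fun q =>
    {x | ⟪x, q.1⟫ ∈ Set.Ioc (q.2 - δ) q.2 ∧ ∀ p ∈ Q, p ≠ q → q.2 - ⟪x, q.1⟫ < p.2 - ⟪x, p.1⟫}
  let G : E × ℝ → Set E := fun q => frontier W ∩ {y | q.2 ≤ ⟪y, q.1⟫ ∧
    ∀ p ∈ Q, p ≠ q → ⟪y - (⟪y, q.1⟫ - q.2) • q.1, p.1⟫ < p.2}
  have hTmeas : ∀ q, MeasurableSet (T q) := by
    intro q
    have h1 : Measurable fun x : E => ⟪x, q.1⟫ := by fun_prop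
    have h2 : T q = (fun x : E => ⟪x, q.1⟫) ⁻¹' Set.Ioc (q.2 - δ) q.2 ∩
        ⋂ p ∈ Q, ⋂ (_ : p ≠ q), {x : E | q.2 - ⟪x, q.1⟫ < p.2 - ⟪x, p.1⟫} := by
      ext x; simp [T]
    rw [h2]
    refine (h1 measurableSet_Ioc).inter ?_
    refine Finset.measurableSet_biInter _ fun p _ => MeasurableSet.iInter fun _ => ?_
    exact measurableSet_lt (by fun_prop) (by fun_prop)
  have hGmeas : ∀ q, MeasurableSet (G q) := by
    intro q
    refine isClosed_frontier.measurableSet.inter ?_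
    have : {y : E | q.2 ≤ ⟪y, q.1⟫ ∧
        ∀ p ∈ Q, p ≠ q → ⟪y - (⟪y, q.1⟫ - q.2) • q.1, p.1⟫ < p.2} =
        {y : E | q.2 ≤ ⟪y, q.1⟫} ∩
        ⋂ p ∈ Q, ⋂ (_ : p ≠ q), {y : E | ⟪y - (⟪y, q.1⟫ - q.2) • q.1, p.1⟫ < p.2} := by
      ext x; simp
    rw [this]
    refine (measurableSet_le (by fun_prop) (by fun_prop)).inter ?_
    refine Finset.measurableSet_biInter _ fun p _ => MeasurableSet.iInter fun _ => ?_
    exact measurableSet_lt (by fun_prop) (by fun_prop)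
  have hTG : ∀ q ∈ Q, ∀ x ∈ T q, ∃ r : ℝ, x + r • q.1 ∈ G q := by
    rintro q hq x ⟨hx1, hx2⟩
    have hq1 := hQ q hq
    -- the foot of `x` on the hyperplane `q`
    set p₀ : E := x + (q.2 - ⟪x, q.1⟫) • q.1 with hp₀
    have hp₀q : ⟪p₀, q.1⟫ = q.2 := by
      simp only [hp₀, inner_add_left, inner_smul_left, real_inner_self_eq_norm_sq, hq1]
      simp
    have hp₀lt : ∀ p ∈ Q, p ≠ q → ⟪p₀, p.1⟫ < p.2 := by
      intro p hp hpq
      have h1 := hx2 p hp hpq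
      have h2 : ⟪q.1, p.1⟫ ≤ 1 := by
        simpa [hq1, hQ p hp] using real_inner_le_norm q.1 p.1
      have h3 : 0 ≤ q.2 - ⟪x, q.1⟫ := by linarith [hx1.2]
      simp only [hp₀, inner_add_left, inner_smul_left, RCLike.conj_to_real]
      nlinarith
    have hp₀W : p₀ ∈ W := hQW fun p hp => by
      by_cases hpq : p = q
      · rw [hpq, hp₀q]
      · exact (hp₀lt p hp hpq).le
    obtain ⟨r, hr0, hr⟩ := exists_add_smul_mem_frontier hW hp₀W
      (u := q.1) (by intro h; simp [h] at hq1)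
    have hpr : ⟪p₀ + r • q.1, q.1⟫ = q.2 + r := by
      rw [inner_add_left, hp₀q, inner_smul_left, real_inner_self_eq_norm_sq, hq1]
      simp
    refine ⟨q.2 - ⟪x, q.1⟫ + r, ?_⟩
    rw [add_smul, ← add_assoc, ← hp₀]
    refine ⟨hr, by rw [hpr]; linarith, fun p hp hpq => ?_⟩
    rw [hpr]
    simpa using hp₀lt p hp hpq
  have hGdisj : (Q : Set (E × ℝ)).PairwiseDisjoint G := by
    intro q hq p hp hqp
    rw [Function.onFun, Set.disjoint_left]
    rintro y ⟨-, hy1, hy2⟩ ⟨-, hy3, hy4⟩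
    -- the projections of `y` along the two normals coincide, being nearest points of a convex set
    set a : E := y - (⟪y, q.1⟫ - q.2) • q.1 with ha
    set c : E := y - (⟪y, p.1⟫ - p.2) • p.1 with hc
    have haq : ⟪a, q.1⟫ = q.2 := by
      simp only [ha, inner_sub_left, inner_smul_left, real_inner_self_eq_norm_sq, hQ q hq]
      simp
    have hcp : ⟪c, p.1⟫ = p.2 := by
      simp only [hc, inner_sub_left, inner_smul_left, real_inner_self_eq_norm_sq, hQ p hp]
      simp
    have hap : ⟪a, p.1⟫ < p.2 := hy2 p hp hqp.symm
    have hcq : ⟪c, q.1⟫ < q.2 := hy4 q hq hqp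
    have h1 : a - c = (⟪y, p.1⟫ - p.2) • p.1 - (⟪y, q.1⟫ - q.2) • q.1 := by
      rw [ha, hc]; abel
    have h2 : ⟪a - c, a - c⟫ ≤ 0 := by
      have h : ⟪a - c, a - c⟫ = (⟪y, p.1⟫ - p.2) * (⟪a, p.1⟫ - ⟪c, p.1⟫) -
          (⟪y, q.1⟫ - q.2) * (⟪a, q.1⟫ - ⟪c, q.1⟫) := by
        rw [← inner_sub_left, ← inner_sub_left, ← inner_smul_right, ← inner_smul_right,
          ← inner_sub_right, ← h1]
      rw [h, haq, hcp]
      nlinarith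
    have h3 : a = c := by
      rw [← sub_eq_zero, ← inner_self_eq_zero (𝕜 := ℝ)]
      exact le_antisymm h2 real_inner_self_nonneg
    rw [h3, hcp] at hap
    exact lt_irrefl _ hap
  have hcover : {x : E | (∀ q ∈ Q, ⟪x, q.1⟫ ≤ q.2) ∧ ∃ q ∈ Q, q.2 - δ < ⟪x, q.1⟫} ⊆
      (⋃ q ∈ Q, T q) ∪ ⋃ z ∈ Q.offDiag, {x : E | z.1.2 - ⟪x, z.1.1⟫ = z.2.2 - ⟪x, z.2.1⟫} := by
    rintro x ⟨hx1, q₀, hq₀, hx2⟩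
    obtain ⟨q, hq, hmin⟩ := Q.exists_min_image (fun q => q.2 - ⟪x, q.1⟫) ⟨q₀, hq₀⟩
    by_cases htie : ∃ p ∈ Q, p ≠ q ∧ q.2 - ⟪x, q.1⟫ = p.2 - ⟪x, p.1⟫
    · obtain ⟨p, hp, hpq, h⟩ := htie
      refine Or.inr (Set.mem_iUnion₂.2 ⟨(q, p), ?_, h⟩)
      simp [hq, hp, hpq.symm]
    · push Not at htie
      refine Or.inl (Set.mem_iUnion₂.2 ⟨q, hq, ⟨?_, hx1 q hq⟩, fun p hp hpq => ?_⟩)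
      · linarith [hmin q₀ hq₀]
      · exact lt_of_le_of_ne (hmin p hp) (htie p hp hpq)
  have hties : volume (⋃ z ∈ Q.offDiag, {x : E | z.1.2 - ⟪x, z.1.1⟫ = z.2.2 - ⟪x, z.2.1⟫}) = 0 := by
    refine (measure_biUnion_null_iff (Q.offDiag.countable_toSet)).2 fun z hz => ?_
    exact volume_slack_eq_slack (Finset.mem_offDiag.1 hz).2.2
  calc _ ≤ volume (⋃ q ∈ Q, T q) := by
        refine (measure_mono hcover).trans ((measure_union_le _ _).trans ?_)
        rw [hties, add_zero]
    _ ≤ ∑ q ∈ Q, volume (T q) := measure_biUnion_finset_le _ _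
    _ ≤ ∑ q ∈ Q, ENNReal.ofReal δ * μHE[Module.finrank ℝ E - 1] (G q) :=
        Finset.sum_le_sum fun q hq =>
          volume_le_of_slab (hQ q hq) (hTmeas q) (fun x hx => hx.1) (hTG q hq)
    _ = ENNReal.ofReal δ * μHE[Module.finrank ℝ E - 1] (⋃ q ∈ Q, G q) := by
        rw [← Finset.mul_sum, measure_biUnion_finset hGdisj fun q _ => hGmeas q]
    _ ≤ _ := by
        gcongr
        exact Set.iUnion₂_subset fun q _ => Set.inter_subset_left

/-- **Volume of the inner parallel body.** For a compact convex set `W`, the points whose closed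
`δ`-ball is contained in `W` fill all of `W` up to a volume of `δ` times the surface area. -/
theorem volume_le_volume_inner_parallel_add {W : Set E} (hW : IsCompact W) (hWc : Convex ℝ W)
    (δ : ℝ) :
    volume W ≤ volume {x : E | Metric.closedBall x δ ⊆ W} +
      ENNReal.ofReal δ * μHE[Module.finrank ℝ E - 1] (frontier W) := by
  have hvol : volume W = volume (interior W) :=
    measure_congr (interior_ae_eq_of_null_frontier (hWc.addHaar_frontier volume)).symm
  rw [hvol]
  refine le_of_forall_lt fun r hr => ?_
  obtain ⟨K, hKW, hK, hrK⟩ := isOpen_interior.exists_lt_isCompact hr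
  have hKne : K.Nonempty := by
    rw [Set.nonempty_iff_ne_empty]
    rintro rfl
    simp at hrK
  -- enlarge `K` to a closed convex subset of the interior of `W`
  obtain ⟨ε, hε, hKε⟩ := hK.exists_cthickening_subset_open isOpen_interior hKW
  have hKL : K ⊆ {x : E | Metric.closedBall x ε ⊆ W} := fun x hx =>
    ((Metric.closedBall_subset_cthickening hx ε).trans hKε).trans interior_subset
  obtain ⟨Q, hQ1, hQ2, hQ3⟩ := exists_polytope_between hW (isClosed_inner_parallel hW.isClosed ε)
    (convex_inner_parallel hWc ε) (hKne.mono hKL) fun x hx =>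
      mem_interior_iff_mem_nhds.2 (Filter.mem_of_superset (Metric.closedBall_mem_nhds x hε) hx)
  refine hrK.trans_le ?_
  have hsub : K ⊆ {x : E | Metric.closedBall x δ ⊆ W} ∪
      {x : E | (∀ q ∈ Q, ⟪x, q.1⟫ ≤ q.2) ∧ ∃ q ∈ Q, q.2 - δ < ⟪x, q.1⟫} := by
    intro x hx
    by_cases h : ∃ q ∈ Q, q.2 - δ < ⟪x, q.1⟫
    · exact Or.inr ⟨hQ2 x (hKL hx), h⟩
    · push Not at h
      refine Or.inl fun y hy => hQ3 fun q hq => ?_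
      have h1 : ⟪y - x, q.1⟫ ≤ δ := by
        refine (real_inner_le_norm _ _).trans ?_
        rw [hQ1 q hq, mul_one, ← dist_eq_norm]
        exact hy
      rw [inner_sub_left] at h1
      linarith [h q hq]
  refine (measure_mono hsub).trans ((measure_union_le _ _).trans ?_)
  gcongr
  exact volume_polytope_shell_le hW Q hQ1 hQ3 δ

end ParallelBody

/-! ### Finiteness of the surface area of a convex body -/

/-- The frontier of a bounded convex set with nonempty interior has finite surface measure: it is
covered by finitely many Lipschitz graphs over bounded subsets of coordinate hyperplanes, according
to which coordinate of an outer normal is largest, and its sign. -/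
theorem hausdorffMeasure_frontier_lt_top {n : ℕ} {W : Set (EuclideanSpace ℝ (Fin (n + 1)))}
    (hW : IsCompact W) (hWc : Convex ℝ W) (hWi : (interior W).Nonempty) :
    μHE[n] (frontier W) < ∞ := by
  -- `A i ε`: the points of `W` with an outer normal `v` whose largest coordinate is `i`-th, with
  -- sign `ε`
  let A : Fin (n + 1) → ℝ → Set (EuclideanSpace ℝ (Fin (n + 1))) := fun i ε =>
    {x ∈ W | ∃ v : EuclideanSpace ℝ (Fin (n + 1)), 0 < ε * v i ∧ (∀ j, |v j| ≤ ε * v i) ∧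
      ∀ y ∈ W, ⟪y, v⟫ ≤ ⟪x, v⟫}
  have hcover : frontier W ⊆ ⋃ i, A i 1 ∪ A i (-1) := by
    intro x hx
    obtain ⟨f, hf0, hf⟩ := geometric_hahn_banach_of_nonempty_interior_point hWc hx.2 hWi
    set v := (InnerProductSpace.toDual ℝ (EuclideanSpace ℝ (Fin (n + 1)))).symm f with hv
    have hfv : ∀ x, f x = ⟪x, v⟫ := fun x => by
      rw [real_inner_comm, hv, InnerProductSpace.toDual_symm_apply]
    have hv0 : v ≠ 0 := by simpa [hv] using hf0
    obtain ⟨i, -, hi⟩ := Finset.univ.exists_max_image (fun i => |v i|) ⟨0, Finset.mem_univ _⟩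
    have hvi : 0 < |v i| := by
      rw [abs_pos]
      intro h
      refine hv0 (PiLp.ext fun j => ?_)
      have := hi j (Finset.mem_univ j)
      rw [h, abs_zero] at this
      simpa using this
    have hsupp : ∀ y ∈ W, ⟪y, v⟫ ≤ ⟪x, v⟫ := fun y hy => by
      rw [← hfv, ← hfv]; exact hf y hy
    have hxW : x ∈ W := hW.isClosed.frontier_subset hx
    refine Set.mem_iUnion.2 ⟨i, ?_⟩
    rcases le_total 0 (v i) with h | h
    · rw [abs_of_nonneg h] at hvi hi
      exact Or.inl ⟨hxW, v, by simpa using hvi, fun j => by simpa using hi j (Finset.mem_univ j),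
        hsupp⟩
    · rw [abs_of_nonpos h] at hvi hi
      exact Or.inr ⟨hxW, v, by simpa using hvi, fun j => by simpa using hi j (Finset.mem_univ j),
        hsupp⟩
  have hA : ∀ i ε, |ε| = 1 → μHE[n] (A i ε) < ∞ := by
    intro i ε hε
    -- the projection dropping the `i`-th coordinate
    let π : EuclideanSpace ℝ (Fin (n + 1)) → EuclideanSpace ℝ (Fin n) := fun x =>
      WithLp.toLp 2 fun j => x (i.succAbove j)
    have hπc : Continuous π := by fun_prop
    have hcoord : ∀ x ∈ A i ε, ∀ y ∈ A i ε, ε * (y i - x i) ≤ n * ‖π x - π y‖ := by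
      rintro x ⟨hx, v, hv1, hv2, hv3⟩ y ⟨hy, -⟩
      have h1 := hv3 y hy
      rw [← sub_nonneg, ← inner_sub_left, PiLp.inner_apply, Fin.sum_univ_succAbove _ i] at h1
      have h2 : ∀ j : Fin n, ⟪(x - y) (i.succAbove j), v (i.succAbove j)⟫ ≤
          ‖π x - π y‖ * (ε * v i) := by
        intro j
        have h3 : |(x - y) (i.succAbove j)| ≤ ‖π x - π y‖ := by
          simpa [π] using PiLp.norm_apply_le (π x - π y) j
        refine (le_abs_self _).trans ?_
        simp only [RCLike.inner_apply, conj_trivial, abs_mul]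
        rw [mul_comm]
        gcongr
        exact hv2 _
      have h4 := Finset.sum_le_sum fun j (_ : j ∈ Finset.univ) => h2 j
      simp only [Finset.sum_const, Finset.card_univ, Fintype.card_fin, nsmul_eq_mul] at h4
      simp only [RCLike.inner_apply, conj_trivial, PiLp.sub_apply] at h1 h4
      have h5 : ε * ε = 1 := by rw [← abs_mul_abs_self, hε, one_mul]
      have h6 : (ε * (y i - x i)) * (ε * v i) ≤ (n * ‖π x - π y‖) * (ε * v i) := by
        have : (ε * (y i - x i)) * (ε * v i) = (ε * ε) * (v i * (y i - x i)) := by ring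
        rw [this, h5]
        linarith
      exact le_of_mul_le_mul_right h6 hv1
    have hanti : ∀ x ∈ A i ε, ∀ y ∈ A i ε, dist x y ≤ (n + 1 : ℝ) * dist (π x) (π y) := by
      intro x hx y hy
      have h1 := hcoord x hx y hy
      have h2 := hcoord y hy x hx
      rw [norm_sub_rev (π y)] at h2
      have h3 : |x i - y i| ≤ n * ‖π x - π y‖ := by
        have : |x i - y i| = |ε * (x i - y i)| := by rw [abs_mul, hε, one_mul]
        rw [this, abs_le]
        constructor <;> linarith
      have h4 : ‖x - y‖ ^ 2 = |x i - y i| ^ 2 + ‖π x - π y‖ ^ 2 := by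
        rw [EuclideanSpace.norm_sq_eq, EuclideanSpace.norm_sq_eq, Fin.sum_univ_succAbove _ i]
        simp [π]
      rw [dist_eq_norm, dist_eq_norm]
      refine abs_le_of_sq_le_sq' ?_ (by positivity) |>.2
      rw [h4]
      have h5 : |x i - y i| ^ 2 ≤ (n * ‖π x - π y‖) ^ 2 := by gcongr
      have h6 : 0 ≤ (n : ℝ) * ‖π x - π y‖ ^ 2 := by positivity
      nlinarith
    have hinj : Set.InjOn π (A i ε) := fun x hx y hy h => by
      have := hanti x hx y hy
      rw [h, dist_self, mul_zero] at this
      exact dist_le_zero.1 this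
    have hlip : LipschitzOnWith (n + 1) (Function.invFunOn π (A i ε)) (π '' A i ε) := by
      refine LipschitzOnWith.of_dist_le_mul ?_
      rintro _ ⟨x, hx, rfl⟩ _ ⟨y, hy, rfl⟩
      rw [hinj.leftInvOn_invFunOn hx, hinj.leftInvOn_invFunOn hy]
      simpa using hanti x hx y hy
    have himage : A i ε = Function.invFunOn π (A i ε) '' (π '' A i ε) :=
      (hinj.leftInvOn_invFunOn.image_image).symm
    have hle := hlip.hausdorffMeasure_image_le (d := (n : ℝ)) (by positivity)
    rw [← himage] at hle
    have hfin : (μHE[n] : Measure (EuclideanSpace ℝ (Fin n))) (π '' A i ε) < ∞ := by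
      rw [EuclideanSpace.euclideanHausdorffMeasure_eq_volume]
      refine (measure_mono (Set.image_mono fun x hx => hx.1)).trans_lt
        (hW.image hπc).measure_lt_top
    simp only [Measure.euclideanHausdorffMeasure_def, Measure.smul_apply] at hfin ⊢
    refine (mul_le_mul_right hle _).trans_lt ?_
    rw [mul_left_comm]
    exact ENNReal.mul_lt_top (ENNReal.rpow_lt_top_of_nonneg (by positivity) (by simp)) hfin
  refine (measure_mono hcover).trans_lt ?_
  refine (measure_iUnion_fintype_le _ _).trans_lt (ENNReal.sum_lt_top.2 fun i _ => ?_)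
  exact measure_union_lt_top (hA i 1 (by simp)) (hA i (-1) (by simp))

/-! ### Tuples of points of a finite configuration -/

section Tuples

variable {E : Type*}

/-- The `k`-tuples with pairwise distinct entries. -/
def distinctTuples (k : ℕ) (E : Type*) : Set (Fin k → E) := {x | Function.Injective x}

/-- The measure counting the `k`-tuples (with repetitions allowed) of points of `s`. -/
def tupleMeasure [MeasurableSpace E] (k : ℕ) (s : Finset E) : Measure (Fin k → E) :=
  ∑ x ∈ Fintype.piFinset fun _ : Fin k => s, Measure.dirac x

variable [MeasurableSpace E]

theorem lintegral_tupleMeasure {k : ℕ} (s : Finset E) {h : (Fin k → E) → ℝ≥0∞}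
    (hh : Measurable h) :
    ∫⁻ x, h x ∂(tupleMeasure k s) = ∑ x ∈ Fintype.piFinset fun _ : Fin k => s, h x := by
  rw [tupleMeasure, lintegral_finsetSum_measure]
  exact Finset.sum_congr rfl fun x _ => lintegral_dirac' x hh

theorem tupleMeasure_pi {k : ℕ} (s : Finset E) {A : Fin k → Set E}
    (hA : ∀ i, MeasurableSet (A i)) :
    tupleMeasure k s (Set.univ.pi A) = ∏ i, (count s (A i) : ℝ≥0∞) := by
  classical
  have hm : MeasurableSet (Set.univ.pi A) := MeasurableSet.univ_pi hA
  rw [← lintegral_indicator_one hm,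
    lintegral_tupleMeasure s (measurable_one.indicator hm)]
  have h1 : ∀ i, (count s (A i) : ℝ≥0∞) = ∑ x ∈ s, (A i).indicator (fun _ => 1) x := by
    intro i
    rw [count, Finset.sum_indicator_eq_sum_filter]
    simp
  simp_rw [h1]
  rw [Finset.prod_univ_sum]
  refine Finset.sum_congr rfl fun x _ => ?_
  by_cases hx : x ∈ Set.univ.pi A
  · rw [Set.indicator_of_mem hx, Finset.prod_eq_one]
    · rfl
    · intro i _
      rw [Set.indicator_of_mem (hx i (Set.mem_univ i))]
  · rw [Set.indicator_of_notMem hx]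
    simp only [Set.mem_univ_pi, not_forall] at hx
    obtain ⟨i, hi⟩ := hx
    exact (Finset.prod_eq_zero (Finset.mem_univ i) (Set.indicator_of_notMem hi _)).symm

instance (k : ℕ) (s : Finset E) : IsFiniteMeasure (tupleMeasure k s) := by
  refine ⟨?_⟩
  have := tupleMeasure_pi (k := k) s (A := fun _ => Set.univ) fun _ => MeasurableSet.univ
  rw [Set.pi_univ] at this
  rw [this]
  exact ENNReal.prod_lt_top fun i _ => by simp

end Tuples

/-! ### Factorial moments of the Poisson process -/

section Poisson

theorem lintegral_natCast_poissonMeasure (r : NNReal) :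
    ∫⁻ n, (n : ℝ≥0∞) ∂(poissonMeasure r) = r := by
  rw [lintegral_countable']
  simp_rw [poissonMeasure_singleton]
  rw [tsum_eq_zero_add' ENNReal.summable]
  have hstep : ∀ n : ℕ, ((n + 1 : ℕ) : ℝ≥0∞) *
      ENNReal.ofReal (Real.exp (-r) * r ^ (n + 1) / (n + 1).factorial) =
      r * poissonMeasure r {n} := by
    intro n
    rw [poissonMeasure_singleton, ← ENNReal.ofReal_natCast, ← ENNReal.ofReal_coe_nnreal,
      ← ENNReal.ofReal_mul (by positivity), ← ENNReal.ofReal_mul (by positivity)]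
    congr 1
    rw [Nat.factorial_succ]
    push_cast
    field_simp
    ring
  simp_rw [hstep]
  have hone := lintegral_countable' (μ := poissonMeasure r) fun _ => 1
  simp only [lintegral_const, measure_univ, one_mul] at hone
  rw [ENNReal.tsum_mul_left, ← hone]
  simp

variable {d : ℕ} {Ω : Type*} [MeasurableSpace Ω] {P : Measure Ω}
  {W : Set (EuclideanSpace ℝ (Fin d))} {t : ℝ} {η : Ω → Finset (EuclideanSpace ℝ (Fin d))}

/-- The intensity measure of the process: `t` times Lebesgue measure, restricted to `W`. -/
def intensity (W : Set (EuclideanSpace ℝ (Fin d))) (t : ℝ) :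
    Measure (EuclideanSpace ℝ (Fin d)) :=
  (ENNReal.ofReal t • volume).restrict W

theorem isFiniteMeasure_intensity (hW : IsCompact W) (t : ℝ) :
    IsFiniteMeasure (intensity W t) := by
  refine ⟨?_⟩
  rw [intensity, Measure.restrict_apply_univ, Measure.smul_apply, smul_eq_mul]
  exact ENNReal.mul_lt_top ENNReal.ofReal_lt_top hW.measure_lt_top

theorem IsPoissonProcess.lintegral_count (hη : IsPoissonProcess P W t η)
    (hW : IsCompact W) (ht : 0 < t)
    {A : Set (EuclideanSpace ℝ (Fin d))} (hA : MeasurableSet A) :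
    ∫⁻ ω, (count (η ω) A : ℝ≥0∞) ∂P = intensity W t A := by
  have h1 := lintegral_map (μ := P) (f := fun n : ℕ => (n : ℝ≥0∞)) (by fun_prop)
    (hη.measurable_count A hA)
  rw [← h1, hη.map_count A hA, lintegral_natCast_poissonMeasure, intensity,
    Measure.restrict_apply hA, Measure.smul_apply, smul_eq_mul, vol, Measure.real]
  change ENNReal.ofReal _ = _
  rw [ENNReal.ofReal_mul ht.le, ENNReal.ofReal_toReal]
  exact ((measure_mono Set.inter_subset_right).trans_lt hW.measure_lt_top).ne

theorem IsPoissonProcess.measurable_tupleMeasure (hη : IsPoissonProcess P W t η) (k : ℕ) :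
    Measurable fun ω => tupleMeasure k (η ω) := by
  have hbox : ∀ A : Fin k → Set (EuclideanSpace ℝ (Fin d)), (∀ i, MeasurableSet (A i)) →
      Measurable fun ω => tupleMeasure k (η ω) (Set.univ.pi A) := by
    intro A hA
    simp_rw [tupleMeasure_pi _ hA]
    refine Finset.measurable_prod _ fun i _ => ?_
    exact (measurable_from_top (f := fun n : ℕ => (n : ℝ≥0∞))).comp (hη.measurable_count _ (hA i))
  refine Measurable.measure_of_isPiSystem generateFrom_pi.symm isPiSystem_pi ?_ ?_
  · rintro _ ⟨A, hA, rfl⟩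
    exact hbox A fun i => hA i (Set.mem_univ i)
  · have := hbox (fun _ => Set.univ) fun _ => MeasurableSet.univ
    rwa [Set.pi_univ] at this

/-- On products of pairwise disjoint sets, the expected number of tuples factorizes. -/
theorem IsPoissonProcess.bind_tupleMeasure_pi (hη : IsPoissonProcess P W t η)
    (hW : IsCompact W) (ht : 0 < t) {k : ℕ}
    {A : Fin k → Set (EuclideanSpace ℝ (Fin d))} (hA : ∀ i, MeasurableSet (A i))
    (hdisj : Pairwise fun i j => Disjoint (A i) (A j)) :
    P.bind (fun ω => tupleMeasure k (η ω)) (Set.univ.pi A) = ∏ i, intensity W t (A i) := by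
  rw [Measure.bind_apply (MeasurableSet.univ_pi hA) (hη.measurable_tupleMeasure k).aemeasurable]
  simp_rw [tupleMeasure_pi _ hA]
  have hcast : Measurable fun n : ℕ => (n : ℝ≥0∞) := measurable_from_top
  rw [lintegral_prod_eq_prod_lintegral_of_indepFun Finset.univ
    (fun i ω => (count (η ω) (A i) : ℝ≥0∞))
    ((hη.indep_count k A hA hdisj).comp (fun _ n => (n : ℝ≥0∞)) fun _ => hcast)
    fun i => hcast.comp (hη.measurable_count _ (hA i))]
  exact Finset.prod_congr rfl fun i _ => hη.lintegral_count hW ht (hA i)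

/-- Away from the diagonals, the expected number of `k`-tuples is the `k`-fold product of the
intensity measure. The tuples of distinct points are covered by countably many products of pairwise
disjoint basic open sets, on which both measures agree by independence. -/
theorem IsPoissonProcess.restrict_bind_tupleMeasure (hη : IsPoissonProcess P W t η)
    (hW : IsCompact W) (ht : 0 < t) (k : ℕ) :
    (P.bind fun ω => tupleMeasure k (η ω)).restrict (distinctTuples k _) =
      (Measure.pi fun _ : Fin k => intensity W t).restrict (distinctTuples k _) := by
  have := isFiniteMeasure_intensity hW t
  let B := TopologicalSpace.countableBasis (EuclideanSpace ℝ (Fin d))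
  have : Countable B := (TopologicalSpace.countable_countableBasis _).to_subtype
  have hBm : ∀ U : B, MeasurableSet (U : Set (EuclideanSpace ℝ (Fin d))) := fun U =>
    (TopologicalSpace.isOpen_of_mem_countableBasis U.2).measurableSet
  let I := {U : Fin k → B // Pairwise fun i j =>
    Disjoint (U i : Set (EuclideanSpace ℝ (Fin d))) (U j)}
  have hcover : distinctTuples k (EuclideanSpace ℝ (Fin d)) =
      ⋃ U : I, Set.univ.pi fun i => (U.1 i : Set (EuclideanSpace ℝ (Fin d))) := by
    ext x
    simp only [distinctTuples, Set.mem_ofPred_eq, Set.mem_iUnion, Set.mem_univ_pi]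
    constructor
    · intro hx
      obtain ⟨V, hV, hVd⟩ := (Set.finite_range x).t2_separation
      have hch : ∀ i, ∃ U : B, x i ∈ (U : Set (EuclideanSpace ℝ (Fin d))) ∧
          (U : Set (EuclideanSpace ℝ (Fin d))) ⊆ V (x i) := fun i => by
        obtain ⟨U, hU, hxU, hUV⟩ :=
          (TopologicalSpace.isBasis_countableBasis
            (EuclideanSpace ℝ (Fin d))).exists_subset_of_mem_open (hV (x i)).1 (hV (x i)).2
        exact ⟨⟨U, hU⟩, hxU, hUV⟩
      choose U hU1 hU2 using hch
      refine ⟨⟨U, fun i j hij => ?_⟩, hU1⟩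
      exact (hVd (Set.mem_range_self i) (Set.mem_range_self j) (hx.ne hij)).mono (hU2 i) (hU2 j)
    · rintro ⟨⟨U, hU⟩, hxU⟩ i j hij
      by_contra hne
      exact Set.disjoint_left.1 (hU hne) (hxU i) (hij ▸ hxU j)
  rw [hcover, Measure.restrict_iUnion_congr]
  rintro ⟨U, hU⟩
  rw [Measure.restrict_pi_pi]
  refine (Measure.pi_eq fun s hs => ?_).symm
  rw [Measure.restrict_apply (MeasurableSet.univ_pi hs), ← Set.pi_inter_distrib,
    hη.bind_tupleMeasure_pi hW ht (fun i => (hs i).inter (hBm _))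
      fun i j hij => (hU hij).mono Set.inter_subset_right Set.inter_subset_right]
  exact Finset.prod_congr rfl fun i _ => (Measure.restrict_apply (hs i)).symm

/-- Almost every tuple for the product of the intensity measure has distinct entries. -/
theorem ae_injective_pi_intensity [NeZero d] (ht : 0 < t) (k : ℕ) :
    ∀ᵐ x ∂(Measure.pi fun _ : Fin k => intensity W t), Function.Injective x := by
  have hk : ∀ i j : Fin k, i ≠ j →
      ∀ᵐ x ∂(Measure.pi fun _ : Fin k => intensity W t), x i ≠ x j := by
    intro i j hij
    have : (ENNReal.ofReal t • (volume : Measure (EuclideanSpace ℝ (Fin d)))).IsAddHaarMeasure :=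
      Measure.IsAddHaarMeasure.smul _ (by simpa using ht) ENNReal.ofReal_ne_top
    have hpi : (Measure.pi fun _ : Fin k => intensity W t) =
        (Measure.pi fun _ : Fin k => ENNReal.ofReal t •
          (volume : Measure (EuclideanSpace ℝ (Fin d)))).restrict (Set.univ.pi fun _ => W) := by
      rw [Measure.restrict_pi_pi]; rfl
    rw [hpi]
    refine ae_restrict_of_ae ?_
    let D : Submodule ℝ (Fin k → EuclideanSpace ℝ (Fin d)) :=
      LinearMap.ker (LinearMap.proj (R := ℝ) (φ := fun _ : Fin k => EuclideanSpace ℝ (Fin d)) i -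
        LinearMap.proj j)
    have hD : D ≠ ⊤ := by
      intro h
      have : Pi.single i (EuclideanSpace.single 0 (1 : ℝ)) ∈ D := h ▸ Submodule.mem_top
      simp [D, hij.symm] at this
    have h0 := Measure.addHaar_submodule (Measure.pi fun _ : Fin k => ENNReal.ofReal t •
          (volume : Measure (EuclideanSpace ℝ (Fin d)))) D hD
    rw [ae_iff]
    convert h0 using 2
    ext x
    simp [D, sub_eq_zero]
  have hall : ∀ᵐ x ∂(Measure.pi fun _ : Fin k => intensity W t), ∀ i j, i ≠ j → x i ≠ x j := by
    refine ae_all_iff.2 fun i => ae_all_iff.2 fun j => ?_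
    by_cases hij : i = j
    · simp [hij]
    · filter_upwards [hk i j hij] with x hx _ using hx
  filter_upwards [hall] with x hx i j hij
  by_contra hne
  exact hx i j hne hij

theorem measurableSet_distinctTuples {k : ℕ} :
    MeasurableSet (distinctTuples k (EuclideanSpace ℝ (Fin d))) := by
  have : distinctTuples k (EuclideanSpace ℝ (Fin d)) =
      ⋂ i, ⋂ j, ⋂ (_ : i ≠ j), {x | x i ≠ x j} := by
    ext x
    simp only [distinctTuples, Set.mem_ofPred_eq, Set.mem_iInter]
    exact ⟨fun hx i j hij => hx.ne hij, fun hx i j hij => by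
      by_contra hne; exact hx i j hne hij⟩
  rw [this]
  refine MeasurableSet.iInter fun i => MeasurableSet.iInter fun j => MeasurableSet.iInter fun _ =>
    (measurableSet_eq_fun (measurable_pi_apply i) (measurable_pi_apply j)).compl

/-- **Factorial moment formula.** The expected sum of `h` over the `k`-tuples of distinct points of
the process is the integral of `h` for the `k`-fold product of the intensity measure. -/
theorem IsPoissonProcess.lintegral_sum_distinctTuples [NeZero d] (hη : IsPoissonProcess P W t η)
    (hW : IsCompact W) (ht : 0 < t) {k : ℕ} {h : (Fin k → EuclideanSpace ℝ (Fin d)) → ℝ≥0∞}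
    (hh : Measurable h) :
    ∫⁻ ω, ∑ x ∈ Fintype.piFinset fun _ : Fin k => η ω, (distinctTuples k _).indicator h x ∂P =
      ∫⁻ x, h x ∂(Measure.pi fun _ : Fin k => intensity W t) := by
  have hm := hh.indicator (measurableSet_distinctTuples (d := d) (k := k))
  simp_rw [← lintegral_tupleMeasure _ hm]
  rw [← Measure.lintegral_bind (hη.measurable_tupleMeasure k).aemeasurable hm.aemeasurable,
    lintegral_indicator measurableSet_distinctTuples, hη.restrict_bind_tupleMeasure hW ht,
    ← lintegral_indicator measurableSet_distinctTuples]
  refine lintegral_congr_ae ?_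
  filter_upwards [ae_injective_pi_intensity ht k] with x hx
  exact Set.indicator_of_mem hx h

end Poisson

/-! ### Products of sums over pairs -/

section PairSums

variable {E : Type*}

theorem sum_piFinset_succ {M : Type*} [AddCommMonoid M] {k : ℕ} [DecidableEq E] (s : Finset E)
    (H : (Fin (k + 1) → E) → M) :
    ∑ x ∈ Fintype.piFinset fun _ : Fin (k + 1) => s, H x =
      ∑ a ∈ s, ∑ y ∈ Fintype.piFinset fun _ : Fin k => s, H (Matrix.vecCons a y) := by
  rw [← Finset.sum_product']
  refine (Finset.sum_bij' (fun p _ => Matrix.vecCons p.1 p.2)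
    (fun x _ => (Matrix.vecHead x, Matrix.vecTail x)) ?_ ?_ ?_ ?_ ?_).symm
  · rintro ⟨a, y⟩ h
    simp only [Finset.mem_product, Fintype.mem_piFinset] at h ⊢
    exact Fin.cases h.1 h.2
  · intro x h
    simp only [Finset.mem_product, Fintype.mem_piFinset] at h ⊢
    exact ⟨h 0, fun i => h i.succ⟩
  · rintro ⟨a, y⟩ _
    simp
  · intro x _
    simp
  · intro _ _
    rfl

theorem lintegral_pi_succ [MeasurableSpace E] (μ : Measure E) [SigmaFinite μ] {k : ℕ}
    {h : (Fin (k + 1) → E) → ℝ≥0∞} (hh : Measurable h) :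
    ∫⁻ x, h x ∂(Measure.pi fun _ => μ) =
      ∫⁻ a, ∫⁻ y, h (Matrix.vecCons a y) ∂(Measure.pi fun _ => μ) ∂μ := by
  have hmp := (measurePreserving_piFinSuccAbove (fun _ : Fin (k + 1) => μ) 0).symm
  rw [← hmp.lintegral_comp hh,
    lintegral_prod (fun p => h ((MeasurableEquiv.piFinSuccAbove (fun _ => E) 0).symm p))
      (hh.comp (MeasurableEquiv.measurable _)).aemeasurable]
  refine lintegral_congr fun a => lintegral_congr fun y => congrArg h ?_
  exact Fin.insertNth_zero' a y

theorem lintegral_pi_two [MeasurableSpace E] (μ : Measure E) [SigmaFinite μ]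
    {h : (Fin 2 → E) → ℝ≥0∞} (hh : Measurable h) :
    ∫⁻ x, h x ∂(Measure.pi fun _ => μ) = ∫⁻ x, ∫⁻ y, h ![x, y] ∂μ ∂μ := by
  have h0 : ∀ y : Fin 0 → E, y = ![] := fun y => Subsingleton.elim _ _
  have hx : ∀ x : E, Measurable fun z : Fin 1 → E => h (Matrix.vecCons x z) := by
    intro x
    refine hh.comp (measurable_pi_iff.2 fun i => ?_)
    refine Fin.cases measurable_const (fun j => ?_) i
    simpa using measurable_pi_apply j
  rw [lintegral_pi_succ _ hh]
  refine lintegral_congr fun x => ?_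
  rw [lintegral_pi_succ _ (hx x)]
  refine lintegral_congr fun y => ?_
  simp [h0]

theorem sum_offDiag_eq {M : Type*} [AddCommMonoid M] [DecidableEq E] (s : Finset E)
    (f : E → E → M) :
    ∑ p ∈ s.offDiag, f p.1 p.2 = ∑ x ∈ s, ∑ y ∈ s, if x ≠ y then f x y else 0 := by
  rw [← Finset.sum_product', ← Finset.sum_filter]
  refine Finset.sum_congr ?_ fun _ _ => rfl
  ext p
  simp [Finset.mem_offDiag, and_assoc]

theorem sum_piFinset_two_indicator {M : Type*} [AddCommMonoid M] [DecidableEq E] (s : Finset E)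
    (f : E → E → M) :
    (∑ x ∈ Fintype.piFinset fun _ : Fin 2 => s,
      (distinctTuples _ E).indicator (fun x => f (x 0) (x 1)) x) = ∑ p ∈ s.offDiag, f p.1 p.2 := by
  have h2 : ∀ a b : E, Function.Injective ![a, b] ↔ a ≠ b := by
    intro a b
    rw [Matrix.vecCons, Fin.cons_injective_iff]
    simp [Function.injective_of_subsingleton]
  have h0 : ∀ y : Fin 0 → E, y = ![] := fun y => Subsingleton.elim _ _
  rw [sum_offDiag_eq]
  simp only [sum_piFinset_succ, Fintype.piFinset_of_isEmpty, Finset.univ_unique,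
    Finset.sum_singleton, h0 default, distinctTuples, Set.indicator_apply, Set.mem_ofPred_eq, h2]
  rfl

/-- For fixed `x ≠ y`, a sum over ordered pairs of distinct points splits according to which points
of the pair belong to `{x, y}`. -/
theorem sum_offDiag_split [DecidableEq E] (s : Finset E) (g : E → E → ℝ≥0∞)
    (hg : ∀ x y, g x y = g y x) {x y : E} (hx : x ∈ s) (hy : y ∈ s) (hxy : x ≠ y) :
    ∑ z ∈ s, ∑ w ∈ s, (if z ≠ w then g z w else 0) =
      (∑ z ∈ s, ∑ w ∈ s, if x ≠ z ∧ x ≠ w ∧ y ≠ z ∧ y ≠ w ∧ z ≠ w then g z w else 0) +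
      2 * (∑ w ∈ s, if x ≠ w ∧ y ≠ w then g x w else 0) +
      2 * (∑ w ∈ s, if x ≠ w ∧ y ≠ w then g y w else 0) + 2 * g x y := by
  have hpt : ∀ z w : E, (if z ≠ w then g z w else 0) =
      (if x ≠ z ∧ x ≠ w ∧ y ≠ z ∧ y ≠ w ∧ z ≠ w then g z w else 0) +
      (if x = z then (if x ≠ w ∧ y ≠ w then g x w else 0) else 0) +
      (if x = w then (if x ≠ z ∧ y ≠ z then g x z else 0) else 0) +
      (if y = z then (if x ≠ w ∧ y ≠ w then g y w else 0) else 0) +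
      (if y = w then (if x ≠ z ∧ y ≠ z then g y z else 0) else 0) +
      (if x = z then (if y = w then g x y else 0) else 0) +
      (if y = z then (if x = w then g x y else 0) else 0) := by
    intro z w
    by_cases h1 : x = z
    · subst h1
      by_cases h2 : y = w
      · subst h2; simp [hxy, hxy.symm]
      · by_cases h3 : x = w
        · subst h3; simp [hxy.symm]
        · simp [h2, h3, hxy.symm]
    · by_cases h2 : y = z
      · subst h2
        by_cases h3 : x = w
        · subst h3; simp [hxy, hxy.symm, hg x y]
        · by_cases h4 : y = w
          · subst h4; simp [hxy]
          · simp [h3, h4, hxy]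
      · by_cases h3 : x = w
        · subst h3; simp [h1, h2, hxy.symm, hg z x, Ne.symm h1]
        · by_cases h4 : y = w
          · subst h4; simp [h1, h2, h3, hg z y, Ne.symm h2]
          · simp [h1, h2, h3, h4]
  simp_rw [hpt, Finset.sum_add_distrib]
  have e1 : ∀ a ∈ s, ∀ u : E → ℝ≥0∞,
      ∑ z ∈ s, ∑ w ∈ s, (if a = z then u w else 0) = ∑ w ∈ s, u w := by
    intro a ha u
    rw [Finset.sum_comm]
    exact Finset.sum_congr rfl fun w _ => by rw [Finset.sum_ite_eq, if_pos ha]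
  have e2 : ∀ a ∈ s, ∀ u : E → ℝ≥0∞,
      ∑ z ∈ s, ∑ w ∈ s, (if a = w then u z else 0) = ∑ z ∈ s, u z := by
    intro a ha u
    exact Finset.sum_congr rfl fun w _ => by rw [Finset.sum_ite_eq, if_pos ha]
  rw [e1 x hx fun w => if x ≠ w ∧ y ≠ w then g x w else 0,
    e2 x hx fun w => if x ≠ w ∧ y ≠ w then g x w else 0,
    e1 y hy fun w => if x ≠ w ∧ y ≠ w then g y w else 0,
    e2 y hy fun w => if x ≠ w ∧ y ≠ w then g y w else 0,
    e1 x hx fun w => if y = w then g x y else 0,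
    e1 y hy fun w => if x = w then g x y else 0, Finset.sum_ite_eq, Finset.sum_ite_eq,
    if_pos hx, if_pos hy]
  ring

/-- The product of two sums over ordered pairs of distinct points, written as sums over tuples of
four, three and two distinct points. -/
theorem sum_offDiag_mul_sum_offDiag [DecidableEq E] (s : Finset E) (f g : E → E → ℝ≥0∞)
    (hf : ∀ x y, f x y = f y x) (hg : ∀ x y, g x y = g y x) :
    (∑ p ∈ s.offDiag, f p.1 p.2) * (∑ p ∈ s.offDiag, g p.1 p.2) =
      (∑ x ∈ Fintype.piFinset fun _ : Fin 4 => s,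
        (distinctTuples _ E).indicator (fun x => f (x 0) (x 1) * g (x 2) (x 3)) x) +
      4 * (∑ x ∈ Fintype.piFinset fun _ : Fin 3 => s,
        (distinctTuples _ E).indicator (fun x => f (x 0) (x 1) * g (x 0) (x 2)) x) +
      2 * (∑ x ∈ Fintype.piFinset fun _ : Fin 2 => s,
        (distinctTuples _ E).indicator (fun x => f (x 0) (x 1) * g (x 0) (x 1)) x) := by
  have hsplit : ∀ x ∈ s, ∀ y ∈ s,
      (if x ≠ y then f x y else 0) * (∑ z ∈ s, ∑ w ∈ s, (if z ≠ w then g z w else 0)) =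
      (∑ z ∈ s, ∑ w ∈ s, if x ≠ y ∧ x ≠ z ∧ x ≠ w ∧ y ≠ z ∧ y ≠ w ∧ z ≠ w then
        f x y * g z w else 0) +
      2 * (∑ w ∈ s, if x ≠ y ∧ x ≠ w ∧ y ≠ w then f x y * g x w else 0) +
      2 * (∑ w ∈ s, if y ≠ x ∧ y ≠ w ∧ x ≠ w then f y x * g y w else 0) +
      2 * (if x ≠ y then f x y * g x y else 0) := by
    intro x hx y hy
    by_cases hxy : x = y
    · simp [hxy]
    · rw [sum_offDiag_split s g hg hx hy hxy, if_pos hxy]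
      simp only [ne_eq, hxy, Ne.symm hxy, not_false_eq_true, true_and, if_true, mul_add,
        Finset.mul_sum, mul_ite, mul_zero, hf y x, and_comm (a := ¬ y = _) (b := ¬ x = _)]
      simp only [mul_left_comm (f x y) 2]
  have hswap : ∑ x ∈ s, ∑ y ∈ s,
      2 * (∑ w ∈ s, if y ≠ x ∧ y ≠ w ∧ x ≠ w then f y x * g y w else 0) =
      ∑ x ∈ s, ∑ y ∈ s,
      2 * (∑ w ∈ s, if x ≠ y ∧ x ≠ w ∧ y ≠ w then f x y * g x w else 0) := Finset.sum_comm
  rw [sum_offDiag_eq, sum_offDiag_eq, Finset.sum_mul]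
  simp_rw [Finset.sum_mul]
  rw [Finset.sum_congr rfl fun x hx => Finset.sum_congr rfl fun y hy => hsplit x hx y hy]
  simp_rw [Finset.sum_add_distrib]
  rw [hswap]
  have hcons : ∀ (k : ℕ) (a : E) (y : Fin k → E),
      Function.Injective (Matrix.vecCons a y) ↔ (∀ i, a ≠ y i) ∧ Function.Injective y := by
    intro k a y
    rw [Matrix.vecCons, Fin.cons_injective_iff]
    simp [eq_comm]
  have h2 : ∀ a b : E, Function.Injective ![a, b] ↔ a ≠ b := by
    intro a b
    simp [hcons, Function.injective_of_subsingleton]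
  have h3 : ∀ a b c : E, Function.Injective ![a, b, c] ↔ a ≠ b ∧ a ≠ c ∧ b ≠ c := by
    intro a b c
    rw [hcons, h2]
    simp [Fin.forall_fin_succ, and_assoc]
  have h4 : ∀ a b c e : E, Function.Injective ![a, b, c, e] ↔
      a ≠ b ∧ a ≠ c ∧ a ≠ e ∧ b ≠ c ∧ b ≠ e ∧ c ≠ e := by
    intro a b c e
    rw [hcons, h3]
    simp [Fin.forall_fin_succ, and_assoc]
  have h0 : ∀ y : Fin 0 → E, y = ![] := fun y => Subsingleton.elim _ _
  simp only [sum_piFinset_succ, Fintype.piFinset_of_isEmpty, Finset.univ_unique,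
    Finset.sum_singleton, h0 default, distinctTuples, Set.indicator_apply, Set.mem_ofPred_eq,
    h4, h3, h2]
  simp only [← Finset.mul_sum]
  simp
  ring

end PairSums

/-! ### First and second moments of sums over pairs -/

section Moments

variable {d : ℕ} {Ω : Type*} [MeasurableSpace Ω] {P : Measure Ω}
  {W : Set (EuclideanSpace ℝ (Fin d))} {t : ℝ} {η : Ω → Finset (EuclideanSpace ℝ (Fin d))}
  {f g : EuclideanSpace ℝ (Fin d) → EuclideanSpace ℝ (Fin d) → ℝ≥0∞}

open Classical in
theorem IsPoissonProcess.measurable_sum_offDiag (hη : IsPoissonProcess P W t η)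
    (hf : Measurable (Function.uncurry f)) :
    Measurable fun ω => ∑ p ∈ (η ω).offDiag, f p.1 p.2 := by
  have hm : Measurable ((distinctTuples 2 _).indicator
      fun x : Fin 2 → EuclideanSpace ℝ (Fin d) => f (x 0) (x 1)) :=
    (hf.comp (f := fun x : Fin 2 → EuclideanSpace ℝ (Fin d) => (x 0, x 1))
      (by fun_prop)).indicator measurableSet_distinctTuples
  simp_rw [← sum_piFinset_two_indicator, ← lintegral_tupleMeasure _ hm]
  exact (Measure.measurable_lintegral hm).comp (hη.measurable_tupleMeasure 2)

open Classical in
/-- First moment: the expected sum over ordered pairs of distinct points. -/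
theorem IsPoissonProcess.lintegral_sum_offDiag [NeZero d] (hη : IsPoissonProcess P W t η)
    (hW : IsCompact W) (ht : 0 < t) (hf : Measurable (Function.uncurry f)) :
    ∫⁻ ω, ∑ p ∈ (η ω).offDiag, f p.1 p.2 ∂P =
      ∫⁻ x, ∫⁻ y, f x y ∂(intensity W t) ∂(intensity W t) := by
  have hm : Measurable fun x : Fin 2 → EuclideanSpace ℝ (Fin d) => f (x 0) (x 1) :=
    hf.comp (f := fun x : Fin 2 → EuclideanSpace ℝ (Fin d) => (x 0, x 1)) (by fun_prop)
  have h1 := hη.lintegral_sum_distinctTuples hW ht hm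
  have := isFiniteMeasure_intensity hW t
  rw [lintegral_pi_two _ hm] at h1
  simp_rw [sum_piFinset_two_indicator] at h1
  exact h1

open Classical in
/-- Second moment: the expected product of two sums over ordered pairs of distinct points. -/
theorem IsPoissonProcess.lintegral_sum_offDiag_mul [NeZero d] (hη : IsPoissonProcess P W t η)
    (hW : IsCompact W) (ht : 0 < t) (hf : Measurable (Function.uncurry f))
    (hg : Measurable (Function.uncurry g)) (hfs : ∀ x y, f x y = f y x)
    (hgs : ∀ x y, g x y = g y x) :
    ∫⁻ ω, (∑ p ∈ (η ω).offDiag, f p.1 p.2) * (∑ p ∈ (η ω).offDiag, g p.1 p.2) ∂P =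
      (∫⁻ x, ∫⁻ y, f x y ∂(intensity W t) ∂(intensity W t)) *
        (∫⁻ x, ∫⁻ y, g x y ∂(intensity W t) ∂(intensity W t)) +
      4 * (∫⁻ x, (∫⁻ y, f x y ∂(intensity W t)) * (∫⁻ y, g x y ∂(intensity W t))
        ∂(intensity W t)) +
      2 * (∫⁻ x, ∫⁻ y, f x y * g x y ∂(intensity W t) ∂(intensity W t)) := by
  have := isFiniteMeasure_intensity hW t
  set μ := intensity W t
  have hmf : ∀ {k : ℕ} (i j : Fin k),
      Measurable fun x : Fin k → EuclideanSpace ℝ (Fin d) => f (x i) (x j) := fun i j =>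
    hf.comp (f := fun x : Fin _ → EuclideanSpace ℝ (Fin d) => (x i, x j)) (by fun_prop)
  have hmg : ∀ {k : ℕ} (i j : Fin k),
      Measurable fun x : Fin k → EuclideanSpace ℝ (Fin d) => g (x i) (x j) := fun i j =>
    hg.comp (f := fun x : Fin _ → EuclideanSpace ℝ (Fin d) => (x i, x j)) (by fun_prop)
  have hfx : ∀ x, Measurable (f x) := fun x => hf.comp measurable_prodMk_left
  have hgx : ∀ x, Measurable (g x) := fun x => hg.comp measurable_prodMk_left
  have hme : ∀ {k : ℕ} {H : (Fin k → EuclideanSpace ℝ (Fin d)) → ℝ≥0∞}, Measurable H →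
      Measurable fun ω => ∑ x ∈ Fintype.piFinset fun _ : Fin k => η ω,
        (distinctTuples k _).indicator H x := fun {k H} hH => by
    have hm := hH.indicator (measurableSet_distinctTuples (d := d) (k := k))
    simp_rw [← lintegral_tupleMeasure _ hm]
    exact (Measure.measurable_lintegral hm).comp (hη.measurable_tupleMeasure k)
  have hm4 : Measurable fun x : Fin 4 → EuclideanSpace ℝ (Fin d) =>
      f (x 0) (x 1) * g (x 2) (x 3) := (hmf 0 1).mul (hmg 2 3)
  have hm3 : Measurable fun x : Fin 3 → EuclideanSpace ℝ (Fin d) =>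
      f (x 0) (x 1) * g (x 0) (x 2) := (hmf 0 1).mul (hmg 0 2)
  have hm2 : Measurable fun x : Fin 2 → EuclideanSpace ℝ (Fin d) =>
      f (x 0) (x 1) * g (x 0) (x 1) := (hmf 0 1).mul (hmg 0 1)
  simp_rw [sum_offDiag_mul_sum_offDiag _ f g hfs hgs]
  rw [lintegral_add_right _ ((hme hm2).const_mul 2),
    lintegral_add_right _ ((hme hm3).const_mul 4),
    lintegral_const_mul _ (hme hm3),
    lintegral_const_mul _ (hme hm2),
    hη.lintegral_sum_distinctTuples hW ht hm4,
    hη.lintegral_sum_distinctTuples hW ht hm3,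
    hη.lintegral_sum_distinctTuples hW ht hm2,
    lintegral_pi_two _ hm2]
  congr 2
  · rw [lintegral_pi_succ _ hm4]
    have hmul : ∀ x y, ∫⁻ z : Fin 2 → EuclideanSpace ℝ (Fin d), f x y * g (z 0) (z 1)
        ∂(Measure.pi fun _ => μ) = f x y * ∫⁻ z, ∫⁻ w, g z w ∂μ ∂μ := by
      intro x y
      rw [lintegral_const_mul _ (hmg 0 1), lintegral_pi_two _ (hmg 0 1)]
      rfl
    have hfi : Measurable fun x => ∫⁻ y, f x y ∂μ := hf.lintegral_prod_right'
    rw [← lintegral_mul_const _ hfi]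
    refine lintegral_congr fun x => ?_
    rw [← lintegral_mul_const _ (hfx x), lintegral_pi_succ]
    · exact lintegral_congr fun y => hmul x y
    · exact ((hfx x).comp (measurable_pi_apply 0)).mul (hmg 1 2)
  · congr 1
    rw [lintegral_pi_succ _ hm3]
    refine lintegral_congr fun x => ?_
    rw [← lintegral_mul_const _ (hfx x), lintegral_pi_two]
    · refine lintegral_congr fun y => ?_
      rw [← lintegral_const_mul _ (hgx x)]
      rfl
    · exact ((hfx x).comp (measurable_pi_apply 0)).mul ((hgx x).comp (measurable_pi_apply 1))

end Moments

/-! ### Radial integrals -/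

section Radial

/-- The truncated power function `s ↦ s ^ γ` on `[0, δ]`. -/
def truncPow (δ γ s : ℝ) : ℝ := if s ≤ δ then s ^ γ else 0

theorem measurable_truncPow (δ γ : ℝ) : Measurable (truncPow δ γ) :=
  Measurable.ite measurableSet_Iic (by fun_prop) measurable_const

theorem truncPow_nonneg {δ γ s : ℝ} (hs : 0 ≤ s) : 0 ≤ truncPow δ γ s := by
  unfold truncPow
  split_ifs
  · positivity
  · exact le_rfl

variable {d : ℕ}

theorem kappa_pos : 0 < kappa d :=
  ENNReal.toReal_pos (Metric.measure_closedBall_pos _ _ one_pos).ne' measure_closedBall_lt_top.ne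

/-- Integration of the truncated power of the distance in polar coordinates. -/
theorem lintegral_truncPow_dist [NeZero d] {δ γ : ℝ} (hδ : 0 < δ) (hγ : -(d : ℝ) < γ)
    (x : EuclideanSpace ℝ (Fin d)) :
    ∫⁻ y, ENNReal.ofReal (truncPow δ γ (dist x y)) =
      ENNReal.ofReal (d * kappa d * δ ^ (γ + d) / (γ + d)) := by
  have hd : 1 ≤ d := NeZero.one_le
  have hrad : ∀ s ∈ Set.Ioi (0 : ℝ), s ^ (d - 1) • truncPow δ γ s =
      (Set.Ioc 0 δ).indicator (fun s => s ^ (γ + d - 1)) s := by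
    intro s hs
    have hs' : 0 < s := hs
    by_cases h : s ≤ δ
    · rw [Set.indicator_of_mem (show s ∈ Set.Ioc 0 δ from ⟨hs', h⟩), truncPow, if_pos h,
        smul_eq_mul, ← Real.rpow_natCast,
        ← Real.rpow_add hs', Nat.cast_sub hd]
      congr 1
      push_cast
      ring
    · rw [Set.indicator_of_notMem fun hm => h hm.2, truncPow, if_neg h, smul_zero]
  have hsub : Set.Ioi (0 : ℝ) ∩ Set.Ioc 0 δ = Set.Ioc 0 δ :=
    Set.inter_eq_right.2 fun s hs => hs.1
  have hint : IntegrableOn (fun s : ℝ => s ^ (d - 1) • truncPow δ γ s) (Set.Ioi 0) := by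
    rw [integrableOn_congr_fun hrad measurableSet_Ioi, IntegrableOn,
      integrable_indicator_iff measurableSet_Ioc, IntegrableOn,
      Measure.restrict_restrict measurableSet_Ioc, Set.inter_comm, hsub]
    exact (intervalIntegrable_iff_integrableOn_Ioc_of_le hδ.le).1
      (intervalIntegral.intervalIntegrable_rpow' (by linarith))
  have hval : ∫ s in Set.Ioi (0 : ℝ), s ^ (d - 1) • truncPow δ γ s = δ ^ (γ + d) / (γ + d) := by
    rw [setIntegral_congr_fun measurableSet_Ioi hrad, setIntegral_indicator measurableSet_Ioc, hsub,
      ← intervalIntegral.integral_of_le hδ.le, integral_rpow (Or.inl (by linarith)),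
      sub_add_cancel, Real.zero_rpow (by linarith), sub_zero]
  have htrans : ∫⁻ y, ENNReal.ofReal (truncPow δ γ (dist x y)) =
      ∫⁻ y : EuclideanSpace ℝ (Fin d), ENNReal.ofReal (truncPow δ γ ‖y‖) := by
    simp_rw [dist_eq_norm]
    exact lintegral_sub_left_eq_self (fun y => ENNReal.ofReal (truncPow δ γ ‖y‖)) x
  have hfin : Module.finrank ℝ (EuclideanSpace ℝ (Fin d)) = d := by simp
  rw [htrans, ← ofReal_integral_eq_lintegral_ofReal, integral_fun_norm_addHaar volume, hfin, hval]
  · congr 1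
    rw [kappa, Measure.real, Measure.real, Measure.addHaar_closedBall_eq_addHaar_ball]
    simp
    ring
  · rw [integrable_fun_norm_addHaar volume, hfin]
    exact hint
  · exact ae_of_all _ fun y => truncPow_nonneg (norm_nonneg y)

end Radial

/-! ### Local integrals of the distance powers -/

section LocalIntegral

variable {d : ℕ} {W : Set (EuclideanSpace ℝ (Fin d))} {t δ : ℝ}

/-- The radial integral `∫_{|y| ≤ δ} |y| ^ γ dy`. -/
def radial (d : ℕ) (δ γ : ℝ) : ℝ := d * kappa d * δ ^ (γ + d) / (γ + d)

theorem radial_nonneg {γ : ℝ} (hδ : 0 < δ) (hγ : -(d : ℝ) < γ) : 0 ≤ radial d δ γ := by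
  have := kappa_pos (d := d)
  have : 0 < γ + d := by linarith
  unfold radial
  positivity

/-- The integral of the truncated power of the distance to `x`, for the intensity measure. -/
def localIntegral (W : Set (EuclideanSpace ℝ (Fin d))) (t δ γ : ℝ)
    (x : EuclideanSpace ℝ (Fin d)) : ℝ≥0∞ :=
  ∫⁻ y, ENNReal.ofReal (truncPow δ γ (dist x y)) ∂(intensity W t)

theorem localIntegral_le [NeZero d] {γ : ℝ} (ht : 0 < t) (hδ : 0 < δ) (hγ : -(d : ℝ) < γ)
    (x : EuclideanSpace ℝ (Fin d)) :
    localIntegral W t δ γ x ≤ ENNReal.ofReal (t * radial d δ γ) := by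
  rw [localIntegral, intensity, ENNReal.ofReal_mul ht.le, radial, ← lintegral_truncPow_dist hδ hγ x,
    ← smul_eq_mul, ← lintegral_smul_measure]
  exact lintegral_mono' Measure.restrict_le_self le_rfl

theorem localIntegral_eq [NeZero d] {γ : ℝ} (ht : 0 < t) (hδ : 0 < δ) (hγ : -(d : ℝ) < γ)
    (hW : MeasurableSet W) {x : EuclideanSpace ℝ (Fin d)} (hx : Metric.closedBall x δ ⊆ W) :
    localIntegral W t δ γ x = ENNReal.ofReal (t * radial d δ γ) := by
  rw [localIntegral, intensity, ENNReal.ofReal_mul ht.le, radial, ← lintegral_truncPow_dist hδ hγ x,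
    ← smul_eq_mul, ← lintegral_smul_measure, ← lintegral_indicator hW]
  refine lintegral_congr fun y => ?_
  by_cases hy : y ∈ W
  · rw [Set.indicator_of_mem hy]
  · have : ¬ dist x y ≤ δ := fun h => hy (hx (by rwa [Metric.mem_closedBall, dist_comm]))
    rw [Set.indicator_of_notMem hy, truncPow, if_neg this, ENNReal.ofReal_zero]

end LocalIntegral

/-! ### Covariance of the length-power functionals -/

section CovarianceBounds

/-- Nonnegative variables whose product has extended expectation `a * b + c`, where `a` and `b` are
their extended expectations, are integrable together with their product, with covariance `c`. -/
theorem covariance_eq_of_lintegral {Ω : Type*} [MeasurableSpace Ω] {P : Measure Ω}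
    [IsProbabilityMeasure P] {X Y : Ω → ℝ} (hX : Measurable X) (hY : Measurable Y) (hX0 : 0 ≤ X)
    (hY0 : 0 ≤ Y) {a b c : ℝ≥0∞} (ha : a ≠ ∞) (hb : b ≠ ∞) (hc : c ≠ ∞)
    (hXa : ∫⁻ ω, ENNReal.ofReal (X ω) ∂P = a) (hYb : ∫⁻ ω, ENNReal.ofReal (Y ω) ∂P = b)
    (hXY : ∫⁻ ω, ENNReal.ofReal (X ω) * ENNReal.ofReal (Y ω) ∂P = a * b + c) :
    Integrable X P ∧ Integrable Y P ∧ Integrable (fun ω => X ω * Y ω) P ∧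
      covariance X Y P = c.toReal := by
  have hXY' : ∫⁻ ω, ENNReal.ofReal (X ω * Y ω) ∂P = a * b + c := by
    rw [← hXY]
    exact lintegral_congr fun ω => ENNReal.ofReal_mul (hX0 ω)
  have hab : a * b ≠ ∞ := ENNReal.mul_ne_top ha hb
  have key : ∀ {Z : Ω → ℝ} {z : ℝ≥0∞}, Measurable Z → 0 ≤ Z → z ≠ ∞ →
      ∫⁻ ω, ENNReal.ofReal (Z ω) ∂P = z → Integrable Z P ∧ ∫ ω, Z ω ∂P = z.toReal := by
    intro Z z hZ hZ0 hz h
    refine ⟨(lintegral_ofReal_ne_top_iff_integrable hZ.aestronglyMeasurable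
      (ae_of_all _ hZ0)).1 (h ▸ hz), ?_⟩
    rw [integral_eq_lintegral_of_nonneg_ae (ae_of_all _ hZ0) hZ.aestronglyMeasurable, h]
  obtain ⟨iX, eX⟩ := key hX hX0 ha hXa
  obtain ⟨iY, eY⟩ := key hY hY0 hb hYb
  obtain ⟨iXY, eXY⟩ := key (hX.mul hY) (fun ω => mul_nonneg (hX0 ω) (hY0 ω))
    (ENNReal.add_ne_top.2 ⟨hab, hc⟩) hXY'
  refine ⟨iX, iY, iXY, ?_⟩
  have hexp : ∀ ω, (X ω - a.toReal) * (Y ω - b.toReal) =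
      X ω * Y ω - (a.toReal * Y ω + b.toReal * X ω - a.toReal * b.toReal) := fun ω => by ring
  have i1 : Integrable (fun ω => a.toReal * Y ω + b.toReal * X ω) P :=
    (iY.const_mul _).add (iX.const_mul _)
  have i2 : Integrable (fun ω => a.toReal * Y ω + b.toReal * X ω - a.toReal * b.toReal) P :=
    i1.sub (integrable_const _)
  have i3 : Integrable (fun ω => X ω * Y ω) P := iXY
  have eXY' : ∫ ω, X ω * Y ω ∂P = a.toReal * b.toReal + c.toReal := by
    rw [← ENNReal.toReal_mul, ← ENNReal.toReal_add hab hc]; exact eXY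
  rw [covariance, eX, eY]
  simp_rw [hexp]
  rw [integral_sub i3 i2, integral_sub i1 (integrable_const _),
    integral_add (iY.const_mul _) (iX.const_mul _), integral_const_mul, integral_const_mul, eX, eY,
    eXY']
  simp
  ring

variable {d : ℕ} {Ω : Type*} [MeasurableSpace Ω] {P : Measure Ω}
  {W : Set (EuclideanSpace ℝ (Fin d))} {t δ : ℝ} {η : Ω → Finset (EuclideanSpace ℝ (Fin d))}

theorem lengthPower_nonneg (δ γ : ℝ) (s : Finset (EuclideanSpace ℝ (Fin d))) :
    0 ≤ lengthPower δ γ s :=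
  mul_nonneg (by norm_num) (Finset.sum_nonneg fun _ _ => truncPow_nonneg dist_nonneg)

open Classical in
theorem ofReal_lengthPower (δ γ : ℝ) (s : Finset (EuclideanSpace ℝ (Fin d))) :
    ENNReal.ofReal (lengthPower δ γ s) =
      ENNReal.ofReal (1 / 2) *
        ∑ p ∈ s.offDiag, ENNReal.ofReal (truncPow δ γ (dist p.1 p.2)) := by
  rw [lengthPower, ENNReal.ofReal_mul (by norm_num)]
  congr 1
  rw [← ENNReal.ofReal_sum_of_nonneg fun _ _ => truncPow_nonneg dist_nonneg]
  rfl

theorem measurable_truncPow_dist (δ γ : ℝ) : Measurable (Function.uncurry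
    fun x y : EuclideanSpace ℝ (Fin d) => ENNReal.ofReal (truncPow δ γ (dist x y))) :=
  ((measurable_truncPow δ γ).comp measurable_dist).ennreal_ofReal

theorem IsPoissonProcess.measurable_lengthPower (hη : IsPoissonProcess P W t η) (δ γ : ℝ) :
    Measurable fun ω => lengthPower δ γ (η ω) := by
  classical
  have h1 : ∀ ω, lengthPower δ γ (η ω) = (ENNReal.ofReal (1 / 2) *
      ∑ p ∈ (η ω).offDiag, ENNReal.ofReal (truncPow δ γ (dist p.1 p.2))).toReal := fun ω => by
    rw [← ofReal_lengthPower, ENNReal.toReal_ofReal (lengthPower_nonneg _ _ _)]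
  simp_rw [h1]
  exact ((hη.measurable_sum_offDiag (measurable_truncPow_dist δ γ)).const_mul _).ennreal_toReal

theorem IsPoissonProcess.lintegral_lengthPower [NeZero d] (hη : IsPoissonProcess P W t η)
    (hW : IsCompact W) (ht : 0 < t) (δ γ : ℝ) :
    ∫⁻ ω, ENNReal.ofReal (lengthPower δ γ (η ω)) ∂P =
      ENNReal.ofReal (1 / 2) * ∫⁻ x, localIntegral W t δ γ x ∂(intensity W t) := by
  classical
  simp_rw [ofReal_lengthPower]
  rw [lintegral_const_mul _ (hη.measurable_sum_offDiag (measurable_truncPow_dist δ γ)),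
    hη.lintegral_sum_offDiag hW ht (measurable_truncPow_dist δ γ)]
  rfl

theorem ae_ne_intensity [NeZero d] (W : Set (EuclideanSpace ℝ (Fin d))) (t : ℝ)
    (x : EuclideanSpace ℝ (Fin d)) : ∀ᵐ y ∂(intensity W t), x ≠ y := by
  have : ∀ᵐ y : EuclideanSpace ℝ (Fin d), x ≠ y := by
    rw [ae_iff]
    convert measure_singleton (μ := volume) x using 2
    ext y
    simp [eq_comm]
  exact ae_restrict_of_ae (Measure.ae_smul_measure this _)

/-- The covariance of two length-power functionals, as an extended nonnegative number. The first
integral comes from two pairs of points of the process with exactly one point in common, the second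
one from two pairs with the same two points. -/
def extCov (W : Set (EuclideanSpace ℝ (Fin d))) (t δ α β : ℝ) : ℝ≥0∞ :=
  (∫⁻ x, localIntegral W t δ α x * localIntegral W t δ β x ∂(intensity W t)) +
    ENNReal.ofReal (1 / 2) * ∫⁻ x, localIntegral W t δ (α + β) x ∂(intensity W t)

theorem IsPoissonProcess.lintegral_lengthPower_mul [NeZero d] (hη : IsPoissonProcess P W t η)
    (hW : IsCompact W) (ht : 0 < t) (δ α β : ℝ) :
    ∫⁻ ω, ENNReal.ofReal (lengthPower δ α (η ω)) * ENNReal.ofReal (lengthPower δ β (η ω)) ∂P =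
      (ENNReal.ofReal (1 / 2) * ∫⁻ x, localIntegral W t δ α x ∂(intensity W t)) *
      (ENNReal.ofReal (1 / 2) * ∫⁻ x, localIntegral W t δ β x ∂(intensity W t)) +
      extCov W t δ α β := by
  classical
  have hmα := measurable_truncPow_dist (d := d) δ α
  have hmβ := measurable_truncPow_dist (d := d) δ β
  have hmm : Measurable fun ω =>
      (∑ p ∈ (η ω).offDiag, ENNReal.ofReal (truncPow δ α (dist p.1 p.2))) *
        ∑ p ∈ (η ω).offDiag, ENNReal.ofReal (truncPow δ β (dist p.1 p.2)) :=
    (hη.measurable_sum_offDiag hmα).mul (hη.measurable_sum_offDiag hmβ)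
  simp_rw [ofReal_lengthPower, mul_mul_mul_comm (ENNReal.ofReal (1 / 2))]
  rw [lintegral_const_mul _ hmm,
    hη.lintegral_sum_offDiag_mul hW ht hmα hmβ (fun x y => by rw [dist_comm])
      (fun x y => by rw [dist_comm])]
  have hdiag : ∫⁻ x, ∫⁻ y, ENNReal.ofReal (truncPow δ α (dist x y)) *
      ENNReal.ofReal (truncPow δ β (dist x y)) ∂(intensity W t) ∂(intensity W t) =
      ∫⁻ x, localIntegral W t δ (α + β) x ∂(intensity W t) := by
    refine lintegral_congr fun x => lintegral_congr_ae ?_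
    -- the law of exponents may fail at distance zero
    filter_upwards [ae_ne_intensity W t x] with y hxy
    rw [← ENNReal.ofReal_mul (truncPow_nonneg dist_nonneg)]
    congr 1
    unfold truncPow
    split_ifs
    · rw [Real.rpow_add (dist_pos.2 hxy)]
    · simp
  have h4 : ENNReal.ofReal (1 / 2) * ENNReal.ofReal (1 / 2) * 4 = 1 := by
    rw [← ENNReal.ofReal_mul (by norm_num), show (4 : ℝ≥0∞) = ENNReal.ofReal 4 by simp,
      ← ENNReal.ofReal_mul (by norm_num)]
    norm_num
  have h2 : ENNReal.ofReal (1 / 2) * ENNReal.ofReal (1 / 2) * 2 = ENNReal.ofReal (1 / 2) := by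
    rw [← ENNReal.ofReal_mul (by norm_num), show (2 : ℝ≥0∞) = ENNReal.ofReal 2 by simp,
      ← ENNReal.ofReal_mul (by norm_num)]
    norm_num
  rw [hdiag, mul_add, mul_add, ← mul_assoc _ 4, ← mul_assoc _ 2, h4, h2, one_mul, extCov,
    add_assoc]
  rfl

/-- The coefficient of the volume in the covariance bounds. -/
def covCoeff (d : ℕ) (t δ α β : ℝ) : ℝ :=
  sigma1 d α β * t ^ 2 * δ ^ (α + β + d) + sigma2 d α β * t ^ 3 * δ ^ (α + β + 2 * d)

theorem covCoeff_eq {α β : ℝ} (hδ : 0 < δ) : covCoeff d t δ α β =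
    t * ((t * radial d δ α) * (t * radial d δ β) + 1 / 2 * (t * radial d δ (α + β))) := by
  have h : δ ^ (α + β + 2 * d) = δ ^ (α + d) * δ ^ (β + d) := by
    rw [← Real.rpow_add hδ]; ring_nf
  rw [covCoeff, sigma1, sigma2, radial, radial, radial, h]
  simp only [div_eq_mul_inv, mul_inv]
  ring

theorem intensity_apply_of_subset (ht : 0 < t) (hW : IsCompact W)
    {A : Set (EuclideanSpace ℝ (Fin d))} (hA : MeasurableSet A) (hAW : A ⊆ W) :
    intensity W t A = ENNReal.ofReal (t * vol A) := by
  rw [intensity, Measure.restrict_apply hA, Set.inter_eq_left.2 hAW, Measure.smul_apply,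
    smul_eq_mul, ENNReal.ofReal_mul ht.le, vol, Measure.real, ENNReal.ofReal_toReal]
  exact ((measure_mono hAW).trans_lt hW.measure_lt_top).ne

theorem lintegral_localIntegral_le [NeZero d] {γ : ℝ} (hW : IsCompact W) (ht : 0 < t) (hδ : 0 < δ)
    (hγ : -(d : ℝ) < γ) : ∫⁻ x, localIntegral W t δ γ x ∂(intensity W t) ≤
      ENNReal.ofReal (t * radial d δ γ * (t * vol W)) := by
  have hr := radial_nonneg (d := d) hδ hγ
  calc _ ≤ ∫⁻ _, ENNReal.ofReal (t * radial d δ γ) ∂(intensity W t) :=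
        lintegral_mono fun x => localIntegral_le ht hδ hγ x
    _ = ENNReal.ofReal (t * radial d δ γ) * intensity W t W := by
        rw [lintegral_const, intensity, Measure.restrict_apply_univ, Measure.restrict_apply_self]
    _ = _ := by
        rw [intensity_apply_of_subset ht hW hW.measurableSet subset_rfl,
          ← ENNReal.ofReal_mul (by positivity)]

/-- Upper bound: the local integrals are at most the radial integrals over the whole space. -/
theorem extCov_le [NeZero d] {α β : ℝ} (hW : IsCompact W) (ht : 0 < t) (hδ : 0 < δ)
    (hα : -(d : ℝ) < α) (hβ : -(d : ℝ) < β) (hαβ : -(d : ℝ) < α + β) :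
    extCov W t δ α β ≤ ENNReal.ofReal (covCoeff d t δ α β * vol W) := by
  have hr1 := radial_nonneg (d := d) hδ hα
  have hr2 := radial_nonneg (d := d) hδ hβ
  have hr3 := radial_nonneg (d := d) hδ hαβ
  have hV : 0 ≤ vol W := measureReal_nonneg
  calc extCov W t δ α β
      ≤ (∫⁻ _, ENNReal.ofReal (t * radial d δ α) * ENNReal.ofReal (t * radial d δ β)
          ∂(intensity W t)) +
        ENNReal.ofReal (1 / 2) * ENNReal.ofReal (t * radial d δ (α + β) * (t * vol W)) := by
        unfold extCov
        gcongr
        · exact localIntegral_le ht hδ hα _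
        · exact localIntegral_le ht hδ hβ _
        · exact lintegral_localIntegral_le hW ht hδ hαβ
    _ = ENNReal.ofReal (t * radial d δ α) * ENNReal.ofReal (t * radial d δ β) * intensity W t W +
        ENNReal.ofReal (1 / 2) * ENNReal.ofReal (t * radial d δ (α + β) * (t * vol W)) := by
        rw [lintegral_const, intensity, Measure.restrict_apply_univ, Measure.restrict_apply_self]
    _ = _ := by
        rw [intensity_apply_of_subset ht hW hW.measurableSet subset_rfl,
          ← ENNReal.ofReal_mul (by positivity), ← ENNReal.ofReal_mul (by positivity),
          ← ENNReal.ofReal_mul (by positivity),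
          ← ENNReal.ofReal_add (by positivity) (by positivity), covCoeff_eq hδ]
        congr 1
        ring

/-- Lower bound: on the inner parallel body the local integrals equal the radial integrals. -/
theorem le_extCov [NeZero d] {α β : ℝ} (hW : IsCompact W) (ht : 0 < t) (hδ : 0 < δ)
    (hα : -(d : ℝ) < α) (hβ : -(d : ℝ) < β) (hαβ : -(d : ℝ) < α + β) :
    ENNReal.ofReal (covCoeff d t δ α β * vol {x | Metric.closedBall x δ ⊆ W}) ≤
      extCov W t δ α β := by
  set A : Set (EuclideanSpace ℝ (Fin d)) := {x | Metric.closedBall x δ ⊆ W} with hA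
  have hAm : MeasurableSet A := (isClosed_inner_parallel hW.isClosed δ).measurableSet
  have hAW : A ⊆ W := fun x hx => hx (Metric.mem_closedBall_self hδ.le)
  have hr1 := radial_nonneg (d := d) hδ hα
  have hr2 := radial_nonneg (d := d) hδ hβ
  have hr3 := radial_nonneg (d := d) hδ hαβ
  have hV : 0 ≤ vol A := measureReal_nonneg
  have hloc : ∀ {γ : ℝ}, -(d : ℝ) < γ → ∀ x ∈ A,
      localIntegral W t δ γ x = ENNReal.ofReal (t * radial d δ γ) := fun hγ x hx =>
    localIntegral_eq ht hδ hγ hW.measurableSet hx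
  have e1 : ∫⁻ x in A, localIntegral W t δ α x * localIntegral W t δ β x ∂(intensity W t) =
      ENNReal.ofReal (t * radial d δ α) * ENNReal.ofReal (t * radial d δ β) * intensity W t A := by
    rw [← setLIntegral_const]
    exact setLIntegral_congr_fun hAm fun x hx => by rw [hloc hα x hx, hloc hβ x hx]
  have e2 : ∫⁻ x in A, localIntegral W t δ (α + β) x ∂(intensity W t) =
      ENNReal.ofReal (t * radial d δ (α + β)) * intensity W t A := by
    rw [← setLIntegral_const]
    exact setLIntegral_congr_fun hAm fun x hx => hloc hαβ x hx
  calc ENNReal.ofReal (covCoeff d t δ α β * vol A)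
      = (∫⁻ x in A, localIntegral W t δ α x * localIntegral W t δ β x ∂(intensity W t)) +
        ENNReal.ofReal (1 / 2) *
          ∫⁻ x in A, localIntegral W t δ (α + β) x ∂(intensity W t) := by
        rw [e1, e2, intensity_apply_of_subset ht hW hAm hAW, ← ENNReal.ofReal_mul (by positivity),
          ← ENNReal.ofReal_mul (by positivity), ← ENNReal.ofReal_mul (by positivity),
          ← ENNReal.ofReal_mul (by positivity),
          ← ENNReal.ofReal_add (by positivity) (by positivity), covCoeff_eq hδ]
        congr 1
        ring
    _ ≤ extCov W t δ α β := by
        unfold extCov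
        gcongr <;> exact Measure.restrict_le_self

/-- The volume of the inner parallel body in terms of volume and surface area, as real numbers. -/
theorem vol_sub_surfaceArea_mul_le [NeZero d] (hW : IsCompact W) (hWc : Convex ℝ W)
    (hWpos : 0 < vol W) (hδ : 0 ≤ δ) :
    vol W - surfaceArea W * δ ≤ vol {x | Metric.closedBall x δ ⊆ W} := by
  have hint : (interior W).Nonempty := by
    rw [Set.nonempty_iff_ne_empty]
    intro h
    have h0 : volume W = volume (interior W) :=
      measure_congr (interior_ae_eq_of_null_frontier (hWc.addHaar_frontier volume)).symm
    rw [vol, Measure.real, h0, h] at hWpos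
    simp at hWpos
  have hS : (μHE[d - 1] : Measure (EuclideanSpace ℝ (Fin d))) (frontier W) ≠ ∞ := by
    obtain ⟨n, rfl⟩ := Nat.exists_eq_succ_of_ne_zero (NeZero.ne d)
    exact (hausdorffMeasure_frontier_lt_top hW hWc hint).ne
  have hle := volume_le_volume_inner_parallel_add hW hWc δ
  rw [show Module.finrank ℝ (EuclideanSpace ℝ (Fin d)) = d by simp] at hle
  have hsub : {x : EuclideanSpace ℝ (Fin d) | Metric.closedBall x δ ⊆ W} ⊆ W := fun x hx =>
    hx (Metric.mem_closedBall_self hδ)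
  have hA := ((measure_mono (μ := volume) hsub).trans_lt hW.measure_lt_top).ne
  have hSδ := ENNReal.mul_ne_top (ENNReal.ofReal_ne_top (r := δ)) hS
  have := ENNReal.toReal_mono (ENNReal.add_ne_top.2 ⟨hA, hSδ⟩) hle
  rw [ENNReal.toReal_add hA hSδ, ENNReal.toReal_mul, ENNReal.toReal_ofReal hδ] at this
  simp only [vol, surfaceArea, Measure.real]
  linarith

/-- Integrability and the two-sided covariance bound. -/
theorem IsPoissonProcess.covariance_bounds [NeZero d] [IsProbabilityMeasure P]
    (hη : IsPoissonProcess P W t η) (hW : IsCompact W) (hWc : Convex ℝ W) (hWpos : 0 < vol W)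
    (ht : 0 < t) (hδ : 0 < δ) {α β : ℝ} (hα : -(d : ℝ) < α) (hβ : -(d : ℝ) < β)
    (hαβ : -(d : ℝ) < α + β) :
    Integrable (fun ω => lengthPower δ α (η ω)) P ∧
    Integrable (fun ω => lengthPower δ β (η ω)) P ∧
    Integrable (fun ω => lengthPower δ α (η ω) * lengthPower δ β (η ω)) P ∧
    covCoeff d t δ α β * (vol W - surfaceArea W * δ) ≤
      covariance (fun ω => lengthPower δ α (η ω)) (fun ω => lengthPower δ β (η ω)) P ∧
    covariance (fun ω => lengthPower δ α (η ω)) (fun ω => lengthPower δ β (η ω)) P ≤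
      covCoeff d t δ α β * vol W := by
  have hr1 := radial_nonneg (d := d) hδ hα
  have hr2 := radial_nonneg (d := d) hδ hβ
  have hr3 := radial_nonneg (d := d) hδ hαβ
  have hc0 : 0 ≤ covCoeff d t δ α β := by rw [covCoeff_eq hδ]; positivity
  have hmean : ∀ {γ : ℝ}, -(d : ℝ) < γ →
      ENNReal.ofReal (1 / 2) * ∫⁻ x, localIntegral W t δ γ x ∂(intensity W t) ≠ ∞ := fun hγ =>
    ENNReal.mul_ne_top ENNReal.ofReal_ne_top
      ((lintegral_localIntegral_le hW ht hδ hγ).trans_lt ENNReal.ofReal_lt_top).ne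
  have hup := extCov_le hW ht hδ hα hβ hαβ
  have hlow := le_extCov hW ht hδ hα hβ hαβ
  have hfin : extCov W t δ α β ≠ ∞ := (hup.trans_lt ENNReal.ofReal_lt_top).ne
  obtain ⟨i1, i2, i3, hcov⟩ := covariance_eq_of_lintegral (hη.measurable_lengthPower δ α)
    (hη.measurable_lengthPower δ β) (fun ω => lengthPower_nonneg δ α (η ω))
    (fun ω => lengthPower_nonneg δ β (η ω)) (hmean hα) (hmean hβ) hfin
    (hη.lintegral_lengthPower hW ht δ α) (hη.lintegral_lengthPower hW ht δ β)
    (hη.lintegral_lengthPower_mul hW ht δ α β)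
  refine ⟨i1, i2, i3, ?_, ?_⟩
  · rw [hcov]
    refine (mul_le_mul_of_nonneg_left (vol_sub_surfaceArea_mul_le hW hWc hWpos hδ.le) hc0).trans ?_
    exact (ENNReal.ofReal_le_iff_le_toReal hfin).1 hlow
  · rw [hcov]
    exact ENNReal.toReal_le_of_le_ofReal (mul_nonneg hc0 hWpos.le) hup

end CovarianceBounds

/-! ### Normalization -/

section Scaling

variable {d : ℕ} {t δ : ℝ}

theorem covCoeff_pos [NeZero d] {α β : ℝ} (ht : 0 < t) (hδ : 0 < δ) (hα : -(d : ℝ) < α)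
    (hβ : -(d : ℝ) < β) (hαβ : -(d : ℝ) < α + β) : 0 < covCoeff d t δ α β := by
  have hd : (0 : ℝ) < d := by exact_mod_cast Nat.pos_of_ne_zero (NeZero.ne d)
  have hκ := kappa_pos (d := d)
  have h1 : 0 < α + d := by linarith
  have h2 : 0 < β + d := by linarith
  have h3 : 0 < α + β + d := by linarith
  unfold covCoeff sigma1 sigma2
  positivity

/-- With `u = t δ ^ d`, the normalization factors out as `t δ ^ (α + d / 2) max (1, √u)`. -/
theorem scale_eq (ht : 0 < t) (hδ : 0 < δ) (α : ℝ) :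
    scale d t δ α = t * δ ^ (α + (d : ℝ) / 2) * max 1 √(t * δ ^ d) := by
  have h : t ^ (3 / 2 : ℝ) * δ ^ (α + (d : ℝ)) = t * δ ^ (α + (d : ℝ) / 2) * √(t * δ ^ d) := by
    rw [Real.sqrt_mul ht.le, Real.sqrt_eq_rpow, Real.sqrt_eq_rpow, ← Real.rpow_natCast,
      ← Real.rpow_mul hδ.le, show (3 / 2 : ℝ) = 1 + 1 / 2 by norm_num, Real.rpow_add ht,
      Real.rpow_one, show α + (d : ℝ) = (α + d / 2) + d * (1 / 2) by ring, Real.rpow_add hδ]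
    ring
  rw [scale, h, mul_max_of_nonneg _ _ (by positivity), mul_one]

theorem covCoeff_div_scale (ht : 0 < t) (hδ : 0 < δ) (α β : ℝ) :
    covCoeff d t δ α β / (scale d t δ α * scale d t δ β) =
      (sigma1 d α β + sigma2 d α β * (t * δ ^ d)) / max 1 (t * δ ^ d) := by
  have hu : 0 < t * δ ^ d := by positivity
  have hmax : max 1 √(t * δ ^ d) * max 1 √(t * δ ^ d) = max 1 (t * δ ^ d) := by
    rcases le_total 1 (t * δ ^ d) with h | h
    · rw [max_eq_right h, max_eq_right (Real.one_le_sqrt.2 h), Real.mul_self_sqrt hu.le]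
    · rw [max_eq_left h, max_eq_left (Real.sqrt_le_one.2 h), one_mul]
  have hpow : δ ^ (α + (d : ℝ) / 2) * δ ^ (β + (d : ℝ) / 2) = δ ^ (α + β + d) := by
    rw [← Real.rpow_add hδ]; ring_nf
  have hs : scale d t δ α * scale d t δ β = t ^ 2 * δ ^ (α + β + d) * max 1 (t * δ ^ d) := by
    rw [scale_eq ht hδ, scale_eq ht hδ, ← hmax, ← hpow]; ring
  have hc : covCoeff d t δ α β =
      t ^ 2 * δ ^ (α + β + d) * (sigma1 d α β + sigma2 d α β * (t * δ ^ d)) := by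
    have h2 : δ ^ (α + β + 2 * d) = δ ^ (α + β + d) * δ ^ d := by
      rw [← Real.rpow_natCast, ← Real.rpow_add hδ]; ring_nf
    rw [covCoeff, h2]
    ring
  have hpos : 0 < δ ^ (α + β + d) := Real.rpow_pos_of_pos hδ _
  rw [hs, hc, mul_div_mul_left _ _ (by positivity)]

end Scaling

/-! ### Limits of the rescaled covariances -/

section Asymptotics

variable {d : ℕ} {Ω : Type*} [MeasurableSpace Ω] {P : Measure Ω} [IsProbabilityMeasure P]
  {W : Set (EuclideanSpace ℝ (Fin d))} {η : ℝ → Ω → Finset (EuclideanSpace ℝ (Fin d))}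
  {δ : ℝ → ℝ} {m : ℕ} {α : Fin m → ℝ}

/-- The rescaled covariances converge as soon as their leading coefficients do. -/
theorem tendsto_covMatrix [NeZero d] (hW : IsCompact W) (hWc : Convex ℝ W) (hWpos : 0 < vol W)
    (hη : ∀ t : ℝ, 0 < t → IsPoissonProcess P W t (η t)) (hδpos : ∀ t : ℝ, 0 < t → 0 < δ t)
    (hδ : Tendsto δ atTop (𝓝 0)) (hα : ∀ i, -(d : ℝ) / 2 < α i)
    {M : Matrix (Fin m) (Fin m) ℝ} {ℓ : Fin m → Fin m → ℝ} (hM : ∀ i j, M i j = ℓ i j * vol W)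
    (hℓ : ∀ i j, Tendsto (fun t => (sigma1 d (α i) (α j) + sigma2 d (α i) (α j) * (t * δ t ^ d)) /
      max 1 (t * δ t ^ d)) atTop (𝓝 (ℓ i j))) :
    Tendsto (fun t : ℝ => covMatrix P (η t) t (δ t) α) atTop (𝓝 M) := by
  have hd : (0 : ℝ) < d := by exact_mod_cast Nat.pos_of_ne_zero (NeZero.ne d)
  refine tendsto_pi_nhds.2 fun i => tendsto_pi_nhds.2 fun j => ?_
  rw [hM]
  have hbounds : ∀ t : ℝ, 0 < t →
      (sigma1 d (α i) (α j) + sigma2 d (α i) (α j) * (t * δ t ^ d)) / max 1 (t * δ t ^ d) *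
        (vol W - surfaceArea W * δ t) ≤ covMatrix P (η t) t (δ t) α i j ∧
      covMatrix P (η t) t (δ t) α i j ≤
        (sigma1 d (α i) (α j) + sigma2 d (α i) (α j) * (t * δ t ^ d)) / max 1 (t * δ t ^ d) *
        vol W := by
    intro t ht
    have hδt := hδpos t ht
    obtain ⟨-, -, -, h1, h2⟩ := (hη t ht).covariance_bounds hW hWc hWpos ht hδt
      (α := α i) (β := α j) (by linarith [hα i]) (by linarith [hα j])
      (by linarith [hα i, hα j])
    have hs : ∀ i, 0 < scale d t (δ t) (α i) := fun i => by
      rw [scale_eq ht hδt]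
      have := Real.rpow_pos_of_pos hδt (α i + (d : ℝ) / 2)
      positivity
    have hss := mul_pos (hs i) (hs j)
    have he : covMatrix P (η t) t (δ t) α i j =
        covariance (fun ω => lengthPower (δ t) (α i) (η t ω))
          (fun ω => lengthPower (δ t) (α j) (η t ω)) P /
          (scale d t (δ t) (α i) * scale d t (δ t) (α j)) := by
      simp only [covMatrix, Matrix.of_apply, div_eq_mul_inv]
      rw [covariance_mul_const_left, covariance_mul_const_right, mul_inv]
      ring
    rw [← covCoeff_div_scale ht hδt, he, div_mul_eq_mul_div, div_mul_eq_mul_div]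
    exact ⟨div_le_div_of_nonneg_right h1 hss.le, div_le_div_of_nonneg_right h2 hss.le⟩
  have hlow := (hℓ i j).mul ((hδ.const_mul (surfaceArea W)).const_sub (vol W))
  rw [mul_zero, sub_zero] at hlow
  refine tendsto_of_tendsto_of_tendsto_of_le_of_le' hlow ((hℓ i j).mul_const (vol W)) ?_ ?_
  · filter_upwards [eventually_gt_atTop 0] with t ht using (hbounds t ht).1
  · filter_upwards [eventually_gt_atTop 0] with t ht using (hbounds t ht).2

theorem Sigma1_apply (i j : Fin m) : Sigma1 W α i j = sigma1 d (α i) (α j) * vol W := by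
  simp only [Sigma1, Matrix.smul_apply, Matrix.of_apply, smul_eq_mul, sigma1, div_eq_mul_inv,
    mul_inv]
  ring

theorem Sigma2_apply (i j : Fin m) : Sigma2 W α i j = sigma2 d (α i) (α j) * vol W := by
  simp only [Sigma2, Matrix.smul_apply, Matrix.of_apply, smul_eq_mul, sigma2, div_eq_mul_inv,
    mul_inv]
  ring

/-- The leading coefficient as a continuous function of `u = t δ ^ d`. -/
theorem tendsto_coeff {u : ℝ → ℝ} {c : ℝ} (hu : Tendsto u atTop (𝓝 c)) (a b : ℝ) :
    Tendsto (fun t => (a + b * u t) / max 1 (u t)) atTop (𝓝 ((a + b * c) / max 1 c)) :=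
  ((hu.const_mul b).const_add a).div (tendsto_const_nhds.max hu)
    (lt_of_lt_of_le one_pos (le_max_left _ _)).ne'

theorem tendsto_coeff_atTop {u : ℝ → ℝ} (hu : Tendsto u atTop atTop) (a b : ℝ) :
    Tendsto (fun t => (a + b * u t) / max 1 (u t)) atTop (𝓝 b) := by
  have h1 : Tendsto (fun t => a * (u t)⁻¹ + b) atTop (𝓝 (a * 0 + b)) :=
    ((tendsto_inv_atTop_zero.comp hu).const_mul a).add_const b
  rw [mul_zero, zero_add] at h1
  refine h1.congr' ?_
  filter_upwards [hu.eventually_ge_atTop 1] with t ht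
  rw [max_eq_right ht]
  have : u t ≠ 0 := by linarith
  field_simp

/-- The relative error of the leading term of the variance is at most `S(W) / V(W)` times `δ`. -/
theorem exists_variance_remainder [NeZero d] (hW : IsCompact W) (hWc : Convex ℝ W)
    (hWpos : 0 < vol W) (hη : ∀ t : ℝ, 0 < t → IsPoissonProcess P W t (η t))
    (hδpos : ∀ t : ℝ, 0 < t → 0 < δ t) {α : ℝ} (hα : -(d : ℝ) / 2 < α) :
    (∀ t : ℝ, 0 < t → MemLp (fun ω => lengthPower (δ t) α (η t ω)) 2 P) ∧
    ∃ r : ℝ → ℝ, r =O[atTop] δ ∧ ∀ t : ℝ, 0 < t →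
      variance (fun ω => lengthPower (δ t) α (η t ω)) P =
        covCoeff d t (δ t) α α * vol W * (1 + r t) := by
  have hd : (0 : ℝ) < d := by exact_mod_cast Nat.pos_of_ne_zero (NeZero.ne d)
  have hα1 : -(d : ℝ) < α := by linarith
  have hα2 : -(d : ℝ) < α + α := by linarith
  have hb := fun t (ht : 0 < t) => (hη t ht).covariance_bounds hW hWc hWpos ht (hδpos t ht)
    hα1 hα1 hα2
  have hmeas := fun t (ht : 0 < t) => (hη t ht).measurable_lengthPower (δ t) α
  have hpos : ∀ t, 0 < t → 0 < covCoeff d t (δ t) α α * vol W := fun t ht =>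
    mul_pos (covCoeff_pos ht (hδpos t ht) hα1 hα1 hα2) hWpos
  refine ⟨fun t ht => ?_, fun t => variance (fun ω => lengthPower (δ t) α (η t ω)) P /
    (covCoeff d t (δ t) α α * vol W) - 1, ?_, fun t ht => ?_⟩
  · rw [memLp_two_iff_integrable_sq (hmeas t ht).aestronglyMeasurable]
    simpa only [sq] using (hb t ht).2.2.1
  · refine IsBigO.of_bound (surfaceArea W / vol W) ?_
    filter_upwards [eventually_gt_atTop 0] with t ht
    obtain ⟨-, -, -, h1, h2⟩ := hb t ht
    have hc := covCoeff_pos ht (hδpos t ht) hα1 hα1 hα2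
    rw [covariance_self (hmeas t ht).aemeasurable] at h1 h2
    rw [Real.norm_eq_abs, Real.norm_eq_abs, abs_of_pos (hδpos t ht), abs_of_nonpos
      (sub_nonpos.2 ((div_le_one (hpos t ht)).2 h2)), neg_sub, sub_le_comm, le_div_iff₀ (hpos t ht)]
    refine le_of_eq_of_le ?_ h1
    field_simp
  · have := (hpos t ht).ne'
    rw [add_sub_cancel, mul_div_cancel₀ _ this]

end Asymptotics

end

end Gilbert

theorem theorem2p3 (d : ℕ) (hd : 1 ≤ d)
    (W : Set (EuclideanSpace ℝ (Fin d))) (hWcompact : IsCompact W) (hWconvex : Convex ℝ W)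
    (hWpos : 0 < Gilbert.vol W)
    {Ω : Type*} [MeasurableSpace Ω] (P : Measure Ω) [IsProbabilityMeasure P]
    (η : ℝ → Ω → Finset (EuclideanSpace ℝ (Fin d)))
    (hη : ∀ t : ℝ, 0 < t → Gilbert.IsPoissonProcess P W t (η t))
    (δ : ℝ → ℝ) (hδpos : ∀ t : ℝ, 0 < t → 0 < δ t) (hδ : Tendsto δ atTop (𝓝 0)) :
    -- the covariances exist, and the two-sided bound
    (∀ α β : ℝ, -(d : ℝ) < α → -(d : ℝ) < β → -(d : ℝ) < α + β → ∀ t : ℝ, 0 < t →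
      Integrable (fun ω => Gilbert.lengthPower (δ t) α (η t ω)) P ∧
      Integrable (fun ω => Gilbert.lengthPower (δ t) β (η t ω)) P ∧
      Integrable (fun ω => Gilbert.lengthPower (δ t) α (η t ω) *
        Gilbert.lengthPower (δ t) β (η t ω)) P ∧
      (Gilbert.sigma1 d α β * t ^ 2 * δ t ^ (α + β + d) +
          Gilbert.sigma2 d α β * t ^ 3 * δ t ^ (α + β + 2 * d)) *
          (Gilbert.vol W - Gilbert.surfaceArea W * δ t) ≤
        covariance (fun ω => Gilbert.lengthPower (δ t) α (η t ω))
          (fun ω => Gilbert.lengthPower (δ t) β (η t ω)) P ∧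
      covariance (fun ω => Gilbert.lengthPower (δ t) α (η t ω))
          (fun ω => Gilbert.lengthPower (δ t) β (η t ω)) P ≤
        (Gilbert.sigma1 d α β * t ^ 2 * δ t ^ (α + β + d) +
          Gilbert.sigma2 d α β * t ^ 3 * δ t ^ (α + β + 2 * d)) * Gilbert.vol W) ∧
    -- the limiting covariance matrix in the different regimes
    (∀ (m : ℕ) (α : Fin m → ℝ), Function.Injective α → (∀ i, -(d : ℝ) / 2 < α i) →
      (Tendsto (fun t : ℝ => t * δ t ^ d) atTop (𝓝 0) →
        Tendsto (fun t : ℝ => Gilbert.covMatrix P (η t) t (δ t) α) atTop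
          (𝓝 (Gilbert.Sigma1 W α))) ∧
      (∀ c : ℝ, 0 < c → c ≤ 1 → Tendsto (fun t : ℝ => t * δ t ^ d) atTop (𝓝 c) →
        Tendsto (fun t : ℝ => Gilbert.covMatrix P (η t) t (δ t) α) atTop
          (𝓝 (Gilbert.Sigma1 W α + c • Gilbert.Sigma2 W α))) ∧
      (∀ c : ℝ, 1 < c → Tendsto (fun t : ℝ => t * δ t ^ d) atTop (𝓝 c) →
        Tendsto (fun t : ℝ => Gilbert.covMatrix P (η t) t (δ t) α) atTop
          (𝓝 ((1 / c) • Gilbert.Sigma1 W α + Gilbert.Sigma2 W α))) ∧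
      (Tendsto (fun t : ℝ => t * δ t ^ d) atTop atTop →
        Tendsto (fun t : ℝ => Gilbert.covMatrix P (η t) t (δ t) α) atTop
          (𝓝 (Gilbert.Sigma2 W α)))) ∧
    -- the variance asymptotics
    (∀ α : ℝ, -(d : ℝ) / 2 < α →
      (∀ t : ℝ, 0 < t → MemLp (fun ω => Gilbert.lengthPower (δ t) α (η t ω)) 2 P) ∧
      ∃ r : ℝ → ℝ, r =O[atTop] δ ∧ ∀ t : ℝ, 0 < t →
        variance (fun ω => Gilbert.lengthPower (δ t) α (η t ω)) P =
          (d * Gilbert.kappa d / (2 * (2 * α + d)) * t ^ 2 * δ t ^ (2 * α + d) +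
            (d : ℝ) ^ 2 * Gilbert.kappa d ^ 2 / (α + d) ^ 2 * t ^ 3 * δ t ^ (2 * α + 2 * d)) *
          Gilbert.vol W * (1 + r t)) := by
  have : NeZero d := ⟨by omega⟩
  refine ⟨fun α β hα hβ hαβ t ht => ?_, fun m α _ hα => ?_, fun α hα => ?_⟩
  · exact (hη t ht).covariance_bounds hWcompact hWconvex hWpos ht (hδpos t ht) hα hβ hαβ
  · refine ⟨fun hu => ?_, fun c _ hc1 hu => ?_, fun c hc1 hu => ?_, fun hu => ?_⟩
    · refine Gilbert.tendsto_covMatrix hWcompact hWconvex hWpos hη hδpos hδ hα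
        (fun i j => Gilbert.Sigma1_apply i j) fun i j => ?_
      have h := Gilbert.tendsto_coeff hu (Gilbert.sigma1 d (α i) (α j))
        (Gilbert.sigma2 d (α i) (α j))
      rwa [mul_zero, add_zero, max_eq_left zero_le_one, div_one] at h
    · refine Gilbert.tendsto_covMatrix hWcompact hWconvex hWpos hη hδpos hδ hα
        (ℓ := fun i j => Gilbert.sigma1 d (α i) (α j) + Gilbert.sigma2 d (α i) (α j) * c)
        (fun i j => ?_) fun i j => ?_
      · rw [Matrix.add_apply, Matrix.smul_apply, Gilbert.Sigma1_apply, Gilbert.Sigma2_apply,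
          smul_eq_mul]
        ring
      · have h := Gilbert.tendsto_coeff hu (Gilbert.sigma1 d (α i) (α j))
          (Gilbert.sigma2 d (α i) (α j))
        rwa [max_eq_left hc1, div_one] at h
    · have hc0 : c ≠ 0 := by linarith
      refine Gilbert.tendsto_covMatrix hWcompact hWconvex hWpos hη hδpos hδ hα
        (ℓ := fun i j => (Gilbert.sigma1 d (α i) (α j) + Gilbert.sigma2 d (α i) (α j) * c) / c)
        (fun i j => ?_) fun i j => ?_
      · rw [Matrix.add_apply, Matrix.smul_apply, Gilbert.Sigma1_apply, Gilbert.Sigma2_apply,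
          smul_eq_mul]
        field_simp
      · have h := Gilbert.tendsto_coeff hu (Gilbert.sigma1 d (α i) (α j))
          (Gilbert.sigma2 d (α i) (α j))
        rwa [max_eq_right hc1.le] at h
    · exact Gilbert.tendsto_covMatrix hWcompact hWconvex hWpos hη hδpos hδ hα
        (fun i j => Gilbert.Sigma2_apply i j) fun i j => Gilbert.tendsto_coeff_atTop hu _ _
  · obtain ⟨hL2, r, hr, hvar⟩ :=
      Gilbert.exists_variance_remainder hWcompact hWconvex hWpos hη hδpos hα
    refine ⟨hL2, r, hr, fun t ht => ?_⟩
    rw [hvar t ht, Gilbert.covCoeff, Gilbert.sigma1, Gilbert.sigma2, two_mul α, sq (α + d)]
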